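/- For real $s$ and $n\ge 0$ let $(s)_n=\prod_{k=0}^{n-1}(s+k)$ (so $(s)_0=1$). The following series converge and have the stated sums: $$\sum_{n=0}^\infty\frac{(\frac12)_n(\frac14)_n(\frac34)_n}{n!^3}\,(3+40n)\,\frac1{7^{4n}}=\frac{49\sqrt3}{9\pi},$$ $$\sum_{n=0}^\infty\frac{(\frac12)_n(\frac14)_n(\frac34)_n}{n!^3}\,(3+28n)\Bigl(-\frac1{48}\Bigr)^n=\frac{16}{\pi\sqrt3},$$ $$\sum_{n=0}^\infty\frac{(\frac12)_n(\frac14)_n(\frac34)_n}{n!^3}\Bigl(-\frac1{48}\Bigr)^n=\frac{2^{3/2}\pi}{3^{5/4}\,\Gamma(\frac34)^4},$$ $$\sum_{n=0}^\infty\frac{(\frac12)_n(\frac16)_n(\frac56)_n}{n!^3}\,(1+11n)\Bigl(\frac4{125}\Bigr)^n=\frac{5\sqrt5}{2\pi\sqrt3},$$ $$\sum_{n=0}^\infty\frac{(\frac12)_n(\frac13)_n(\frac23)_n}{n!^3}\,(1+5n)\Bigl(-\frac9{16}\Bigr)^n=\frac4{\pi\sqrt3}.$$ -/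

import Mathlib

/-- Pochhammer's symbol `(s)_n = s (s + 1) ⋯ (s + n - 1)`, with `(s)_0 = 1`. -/
noncomputable def poch (s : ℝ) (n : ℕ) : ℝ := (ascPochhammer ℝ n).eval s

/-- The coefficient `(1/2)_n (s)_n (1 - s)_n / n!³`. -/
noncomputable def ramanujanCoeff (s : ℝ) (n : ℕ) : ℝ :=
  poch (1 / 2) n * poch s n * poch (1 - s) n / (n.factorial : ℝ) ^ 3

/-- The product form of Pochhammer's symbol. -/
theorem poch_eq_prod (s : ℝ) (n : ℕ) : poch s n = ∏ k ∈ Finset.range n, (s + (k : ℝ)) := by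
  induction n with
  | zero => simp [poch]
  | succ n ih =>
    rw [Finset.prod_range_succ, ← ih]
    simp [poch, ascPochhammer_succ_eval]

/-! By Clausen's formula, ∑ C_n X^n with C_n = `ramanujanCoeff s n` equals F(X)², where F = ₂F₁(s/2,
(1-s)/2; 1; ·), and X d/dX inserts a factor n (`hasSum_ramanujanCoeff`,
`hasSum_mul_ramanujanCoeff`). A sum with linear factor c + dn is therefore c F² + 2d X F F' at one
point X, and F, F' must be found there.

They come from an algebraic transformation F(X(p)) = m(p) g(T(p)), with g = ₂F₁(a, b; 1; ·), T(0) =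
0 and T(p₀) = 1. As t → 1⁻, Gauss's theorem with Abel's gives g(t) → G = Γ(1-a-b)/(Γ(1-a)Γ(1-b)),
while g'(t) ~ K (1-t)^(-(a+b)) with K = Γ(a+b)/(Γ(a)Γ(b)). In each case 1 - T has a zero of order k
at p₀ with a + b = 1 - 1/k, so T' is κ (1-T)^(a+b) with κ continuous, and g'(T) T' has a finite
limit. Hence F = mG and F' is a combination of G and K, so the sum has the form αG² + βGK. The ratio
c : d is the one that makes α vanish; the reflection formula turns GK into sines divided by π, which
is the source of 1/π. The sum with Γ(3/4) is m²G² alone.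

The transformation itself needs no modular forms. Both sides solve one second-order equation,
singular at p = 0, so a suitable multiple of their Wronskian is constant and vanishes at 0; their
quotient is then constant and equals 1. For each choice of X, T, m this leaves identities between
rational functions, the fields of `GaussTransformation`; the four instances supply the five sums. -/

open Filter Topology Set

/-! ### Power series with polynomially bounded coefficients -/

/-- The coefficients `c` grow at most polynomially. -/
def PolyBounded (c : ℕ → ℝ) : Prop := ∃ (C : ℝ) (k : ℕ), ∀ n, |c n| ≤ C * ((n : ℝ) + 1) ^ k

/-- The coefficients of the derivative of `∑ c n * t ^ n`. -/
def derivCoeff (c : ℕ → ℝ) (n : ℕ) : ℝ := ((n : ℝ) + 1) * c (n + 1)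

theorem PolyBounded.derivCoeff {c : ℕ → ℝ} (hc : PolyBounded c) : PolyBounded (derivCoeff c) := by
  obtain ⟨C, k, h⟩ := hc
  have hC : 0 ≤ C := by simpa using (abs_nonneg _).trans (h 0)
  refine ⟨C * 2 ^ k, k + 1, fun n => ?_⟩
  have hn : (0 : ℝ) ≤ n := n.cast_nonneg
  have h1 := h (n + 1)
  push_cast at h1
  unfold _root_.derivCoeff
  rw [abs_mul, abs_of_nonneg (by positivity : (0 : ℝ) ≤ n + 1)]
  calc ((n : ℝ) + 1) * |c (n + 1)| ≤ ((n : ℝ) + 1) * (C * ((n : ℝ) + 1 + 1) ^ k) := by gcongr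
    _ ≤ ((n : ℝ) + 1) * (C * (2 * ((n : ℝ) + 1)) ^ k) := by gcongr; linarith
    _ = C * 2 ^ k * ((n : ℝ) + 1) ^ (k + 1) := by rw [mul_pow]; ring

theorem summable_succ_pow_mul_geometric (k : ℕ) {r : ℝ} (hr : 0 ≤ r) (hr1 : r < 1) :
    Summable fun n : ℕ => ((n : ℝ) + 1) ^ k * r ^ n := by
  rcases hr.eq_or_lt with rfl | hr0
  · refine summable_of_ne_finset_zero (s := {0}) fun n hn => ?_
    simp [zero_pow (by simpa using hn : n ≠ 0)]
  · have h := summable_pow_mul_geometric_of_norm_lt_one (R := ℝ) k (r := r)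
      (by rwa [Real.norm_of_nonneg hr])
    have h2 := ((summable_nat_add_iff 1).2 h).mul_right r⁻¹
    refine h2.congr fun n => ?_
    push_cast
    rw [pow_succ]
    field_simp

theorem PolyBounded.summable {c : ℕ → ℝ} (hc : PolyBounded c) {t : ℝ} (ht : |t| < 1) :
    Summable fun n => c n * t ^ n := by
  obtain ⟨C, k, h⟩ := hc
  refine Summable.of_norm_bounded
    ((summable_succ_pow_mul_geometric k (abs_nonneg t) ht).mul_left C) fun n => ?_
  rw [Real.norm_eq_abs, abs_mul, abs_pow, ← mul_assoc]
  gcongr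
  exact h n

/-- Term-by-term differentiation on (-r, r) with |t| < r < 1, where the derivatives are dominated by
the convergent series of |n c n| r^(n-1). -/
theorem PolyBounded.hasDerivAt {c : ℕ → ℝ} (hc : PolyBounded c) {t : ℝ} (ht : |t| < 1) :
    HasDerivAt (fun x => ∑' n, c n * x ^ n) (∑' n, _root_.derivCoeff c n * t ^ n) t := by
  obtain ⟨r, hr, hr1⟩ := exists_between ht
  have hr0 : 0 ≤ r := (abs_nonneg t).trans hr.le
  have hd := hc.derivCoeff
  have hsum : Summable fun n : ℕ => |(n : ℝ) * c n| * r ^ (n - 1) := by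
    rw [← summable_nat_add_iff 1]
    obtain ⟨C, k, h⟩ := hd
    refine Summable.of_nonneg_of_le (fun n => by positivity) (fun n => ?_)
      ((summable_succ_pow_mul_geometric k hr0 hr1).mul_left C)
    have := h n
    unfold _root_.derivCoeff at this
    push_cast
    rw [← mul_assoc]
    gcongr
  have key := hasDerivAt_tsum_of_isPreconnected (t := Ioo (-r) r)
    (g := fun n x => c n * x ^ n) (g' := fun n x => c n * ((n : ℝ) * x ^ (n - 1))) (y₀ := 0) (y := t)
    hsum isOpen_Ioo isPreconnected_Ioo
    (fun n y _ => (hasDerivAt_pow n y).const_mul (c n))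
    (fun n y hy => by
      rw [Real.norm_eq_abs, ← mul_assoc, mul_comm (c n), abs_mul, abs_pow]
      gcongr
      exact (abs_lt.2 hy).le)
    ⟨by linarith [(abs_nonneg t).trans_lt hr], (abs_nonneg t).trans_lt hr⟩
    (hc.summable (by simp)) (abs_lt.1 hr)
  have hs : Summable fun n : ℕ => c n * ((n : ℝ) * t ^ (n - 1)) := by
    refine Summable.of_norm_bounded hsum fun n => ?_
    rw [Real.norm_eq_abs, ← mul_assoc, mul_comm (c n), abs_mul, abs_pow]
    gcongr
  -- The term n = 0 carries the factor 0, so the truncated exponent n - 1 is harmless there.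
  rw [hs.tsum_eq_zero_add] at key
  simp only [Nat.cast_zero, zero_mul, mul_zero, zero_add] at key
  refine key.congr_deriv (tsum_congr fun n => ?_)
  unfold _root_.derivCoeff
  push_cast
  ring

/-! ### The hypergeometric function `₂F₁(a, b; 1; t)` -/

theorem poch_zero (s : ℝ) : poch s 0 = 1 := by simp [poch]

theorem poch_succ (s : ℝ) (n : ℕ) : poch s (n + 1) = poch s n * (s + n) := by
  simp [poch, ascPochhammer_succ_eval]

theorem poch_pos {s : ℝ} (hs : 0 < s) (n : ℕ) : 0 < poch s n := by
  rw [poch_eq_prod]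
  exact Finset.prod_pos fun k _ => by positivity

theorem poch_le_factorial {s : ℝ} (hs : 0 < s) (hs1 : s ≤ 1) (n : ℕ) :
    poch s n ≤ n.factorial := by
  induction n with
  | zero => simp [poch_zero]
  | succ n ih =>
    rw [poch_succ, Nat.factorial_succ, mul_comm]
    push_cast
    exact mul_le_mul (by linarith) ih (poch_pos hs n).le (by positivity)

/-- The coefficients of `₂F₁(a, b; 1; t)`. -/
noncomputable def gaussCoeff (a b : ℝ) (n : ℕ) : ℝ :=
  poch a n * poch b n / (n.factorial : ℝ) ^ 2

/-- The function `₂F₁(a, b; 1; t)`. -/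
noncomputable def gaussF (a b t : ℝ) : ℝ := ∑' n, gaussCoeff a b n * t ^ n

/-- The derivative of `₂F₁(a, b; 1; t)`. -/
noncomputable def gaussF' (a b t : ℝ) : ℝ := ∑' n, derivCoeff (gaussCoeff a b) n * t ^ n

/-- The second derivative of `₂F₁(a, b; 1; t)`. -/
noncomputable def gaussF'' (a b t : ℝ) : ℝ :=
  ∑' n, derivCoeff (derivCoeff (gaussCoeff a b)) n * t ^ n

theorem gaussCoeff_zero (a b : ℝ) : gaussCoeff a b 0 = 1 := by simp [gaussCoeff, poch_zero]

theorem gaussCoeff_succ (a b : ℝ) (n : ℕ) :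
    ((n : ℝ) + 1) ^ 2 * gaussCoeff a b (n + 1) = (n + a) * (n + b) * gaussCoeff a b n := by
  have : (n.factorial : ℝ) ≠ 0 := by positivity
  simp only [gaussCoeff, poch_succ, Nat.factorial_succ]
  push_cast
  field_simp
  ring

theorem gaussCoeff_pos {a b : ℝ} (ha : 0 < a) (hb : 0 < b) (n : ℕ) : 0 < gaussCoeff a b n := by
  have := poch_pos ha n
  have := poch_pos hb n
  unfold gaussCoeff
  positivity

theorem gaussCoeff_polyBounded {a b : ℝ} (ha : 0 < a) (ha1 : a ≤ 1) (hb : 0 < b) (hb1 : b ≤ 1) :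
    PolyBounded (gaussCoeff a b) := by
  refine ⟨1, 0, fun n => ?_⟩
  rw [abs_of_pos (gaussCoeff_pos ha hb n), gaussCoeff, pow_zero, mul_one, div_le_one (by positivity),
    sq]
  exact mul_le_mul (poch_le_factorial ha ha1 n) (poch_le_factorial hb hb1 n) (poch_pos hb n).le
    (by positivity)

theorem gaussF_zero (a b : ℝ) : gaussF a b 0 = 1 := by
  unfold gaussF
  rw [tsum_eq_single 0 fun n hn => by simp [hn]]
  simp [gaussCoeff_zero]

theorem hasDerivAt_gaussF {a b : ℝ} (ha : 0 < a) (ha1 : a ≤ 1) (hb : 0 < b) (hb1 : b ≤ 1)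
    {t : ℝ} (ht : |t| < 1) : HasDerivAt (gaussF a b) (gaussF' a b t) t :=
  (gaussCoeff_polyBounded ha ha1 hb hb1).hasDerivAt ht

theorem hasDerivAt_gaussF' {a b : ℝ} (ha : 0 < a) (ha1 : a ≤ 1) (hb : 0 < b) (hb1 : b ≤ 1)
    {t : ℝ} (ht : |t| < 1) : HasDerivAt (gaussF' a b) (gaussF'' a b t) t :=
  (gaussCoeff_polyBounded ha ha1 hb hb1).derivCoeff.hasDerivAt ht

theorem gaussF_pos {a b : ℝ} (ha : 0 < a) (ha1 : a ≤ 1) (hb : 0 < b) (hb1 : b ≤ 1)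
    {t : ℝ} (ht : 0 ≤ t) (ht1 : t < 1) : 0 < gaussF a b t := by
  have h := (gaussCoeff_polyBounded ha ha1 hb hb1).summable (t := t) (by rwa [abs_of_nonneg ht])
  refine h.tsum_pos (fun n => ?_) 0 (by simp [gaussCoeff_zero])
  have := gaussCoeff_pos ha hb n
  positivity

/-- Multiplication of a power series by t shifts its coefficients; this is how factors n and n (n -
1) are traded for t F' and t² F''. -/
theorem HasSum.of_shift {f g : ℕ → ℝ} {S t : ℝ} (hg : HasSum g S) (h0 : f 0 = 0)
    (h : ∀ n, f (n + 1) = t * g n) : HasSum f (t * S) := by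
  have := hg.mul_left t
  rw [← funext h, hasSum_nat_add_iff] at this
  simpa [h0] using this

/-- The coefficient of t^n on the left is (n+1)² c (n+1) - (n+a)(n+b) c n, which vanishes by the
recurrence `gaussCoeff_succ`. -/
theorem gaussF_ode {a b : ℝ} (ha : 0 < a) (ha1 : a ≤ 1) (hb : 0 < b) (hb1 : b ≤ 1)
    {t : ℝ} (ht : |t| < 1) :
    t * (1 - t) * gaussF'' a b t + (1 - (a + b + 1) * t) * gaussF' a b t - a * b * gaussF a b t
      = 0 := by
  have hc := gaussCoeff_polyBounded ha ha1 hb hb1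
  have h0 := (hc.summable ht).hasSum
  have h1 := (hc.derivCoeff.summable ht).hasSum
  have h2 := (hc.derivCoeff.derivCoeff.summable ht).hasSum
  have h1t : HasSum (fun n : ℕ => (n : ℝ) * gaussCoeff a b n * t ^ n) (t * gaussF' a b t) := by
    refine h1.of_shift (by simp) fun n => ?_
    simp only [derivCoeff]
    push_cast
    ring
  have h2t : HasSum (fun n : ℕ => (n : ℝ) * derivCoeff (gaussCoeff a b) n * t ^ n)
      (t * gaussF'' a b t) := by
    refine h2.of_shift (by simp) fun n => ?_
    simp only [derivCoeff]
    push_cast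
    ring
  have h2tt : HasSum (fun n : ℕ => (n : ℝ) * ((n : ℝ) - 1) * gaussCoeff a b n * t ^ n)
      (t * (t * gaussF'' a b t)) := by
    refine h2t.of_shift (by simp) fun n => ?_
    simp only [derivCoeff]
    push_cast
    ring
  have key := ((h2t.sub h2tt).add (h1.sub (h1t.mul_left (a + b + 1)))).sub (h0.mul_left (a * b))
  have hz : (fun n : ℕ => (n : ℝ) * derivCoeff (gaussCoeff a b) n * t ^ n
      - (n : ℝ) * ((n : ℝ) - 1) * gaussCoeff a b n * t ^ n
      + (derivCoeff (gaussCoeff a b) n * t ^ n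
        - (a + b + 1) * ((n : ℝ) * gaussCoeff a b n * t ^ n))
      - a * b * (gaussCoeff a b n * t ^ n)) = fun _ => 0 := by
    funext n
    simp only [derivCoeff]
    linear_combination t ^ n * gaussCoeff_succ a b n
  rw [hz] at key
  have := key.unique hasSum_zero
  change t * gaussF'' a b t - t * (t * gaussF'' a b t)
    + (gaussF' a b t - (a + b + 1) * (t * gaussF' a b t)) - a * b * gaussF a b t = 0 at this
  linear_combination this

/-! ### Clausen's formula -/

theorem PowerSeries.coeff_X_mul_derivative (f : PowerSeries ℝ) (n : ℕ) :
    PowerSeries.coeff n (PowerSeries.X * PowerSeries.derivative ℝ f)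
      = n * PowerSeries.coeff n f := by
  cases n with
  | zero => simp
  | succ n => rw [PowerSeries.coeff_succ_X_mul, PowerSeries.coeff_derivative]; push_cast; ring

/-- The Cauchy square of the series `₂F₁(a, b; 1; t)` with `a + b = 1 / 2` satisfies the recurrence
of a series `₃F₂(2a, 1 / 2, 2b; 1, 1; t)`. -/
theorem coeff_sq_gaussCoeff_succ {a b : ℝ} (hab : a + b = 1 / 2) (n : ℕ) :
    ((n : ℝ) + 1) ^ 3 * PowerSeries.coeff (n + 1) (PowerSeries.mk (gaussCoeff a b) ^ 2)
      = (n + 1 / 2) * (n + 2 * a) * (n + 2 * b) *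
        PowerSeries.coeff n (PowerSeries.mk (gaussCoeff a b) ^ 2) := by
  set f := PowerSeries.mk (gaussCoeff a b) with hf
  let D := PowerSeries.derivative ℝ
  let θ : PowerSeries ℝ → PowerSeries ℝ := fun g => PowerSeries.X * D g
  have hθc : ∀ g n, PowerSeries.coeff n (θ g) = n * PowerSeries.coeff n g :=
    fun g n => PowerSeries.coeff_X_mul_derivative g n
  have hθmul : ∀ g h, θ (g * h) = g * θ h + h * θ g := fun g h => by
    simp only [θ, Derivation.leibniz, smul_eq_mul]
    ring
  have hθadd : ∀ g h, θ (g + h) = θ g + θ h := fun g h => by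
    simp only [θ, map_add]
    ring
  have hθC : ∀ (r : ℝ) g, θ (PowerSeries.C r * g) = PowerSeries.C r * θ g := fun r g => by
    simp only [θ, Derivation.leibniz, smul_eq_mul, D, PowerSeries.derivative_C]
    ring
  have hθX : θ PowerSeries.X = PowerSeries.X := by simp [θ, D]
  clear_value θ
  -- The hypergeometric equation θ² f = X (θ+a)(θ+b) f, with a + b = 1/2 inserted.
  have e1 : θ (θ f) = PowerSeries.X * (θ (θ f) + PowerSeries.C (1 / 2) * θ f
      + PowerSeries.C (a * b) * f) := by
    ext n
    cases n with
    | zero => simp [hθc]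
    | succ n =>
      simp only [PowerSeries.coeff_succ_X_mul, hθc, map_add, PowerSeries.coeff_C_mul, hf,
        PowerSeries.coeff_mk]
      push_cast
      rw [← hab]
      linear_combination gaussCoeff_succ a b n
  have e2 := congrArg θ e1
  rw [hθmul, hθadd, hθadd, hθC, hθC, hθX] at e2
  have y1 : θ (f ^ 2) = 2 * (f * θ f) := by rw [sq, hθmul]; ring
  have two : (2 : PowerSeries ℝ) = PowerSeries.C (2 : ℝ) := (map_ofNat _ 2).symm
  have y2 : θ (θ (f ^ 2)) = 2 * (θ f * θ f + f * θ (θ f)) := by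
    rw [y1, two, hθC, hθmul]; ring
  have y3 : θ (θ (θ (f ^ 2))) = 2 * (3 * (θ f * θ (θ f)) + f * θ (θ (θ f))) := by
    rw [y2, two, hθC, hθadd, hθmul, hθmul]; ring
  have half : (2 : PowerSeries ℝ) * PowerSeries.C (1 / 2 : ℝ) = 1 := by
    rw [two, ← map_mul]; simp
  obtain ⟨k, hk⟩ : ∃ k, k = 1 / 2 + 4 * (a * b) := ⟨_, rfl⟩
  -- The operator on the right is X (θ+1/2)(θ+2a)(θ+2b) expanded, using 2a + 2b = 1. Since θ³(f²) =
  -- 6 θf θ²f + 2f θ³f, it is obtained from 6 θf times the equation of f and 2f times its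
  -- θ-derivative.
  have key : θ (θ (θ (f ^ 2))) = PowerSeries.X * (θ (θ (θ (f ^ 2)))
      + PowerSeries.C (3 / 2) * θ (θ (f ^ 2)) + PowerSeries.C k * θ (f ^ 2)
      + PowerSeries.C (2 * (a * b)) * f ^ 2) := by
    have c1 : PowerSeries.C (3 / 2 : ℝ) = 3 * PowerSeries.C (1 / 2 : ℝ) := by
      rw [show (3 : PowerSeries ℝ) = PowerSeries.C (3 : ℝ) from (map_ofNat _ 3).symm, ← map_mul]; norm_num
    have c2 : PowerSeries.C (1 / 2 + 4 * (a * b) : ℝ)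
        = PowerSeries.C (1 / 2 : ℝ) + 4 * PowerSeries.C (a * b) := by
      rw [show (4 : PowerSeries ℝ) = PowerSeries.C (4 : ℝ) from (map_ofNat _ 4).symm, ← map_mul, ← map_add]
    have c3 : PowerSeries.C (2 * (a * b) : ℝ) = 2 * PowerSeries.C (a * b) := by
      rw [two, ← map_mul]
    rw [c1, hk, c2, c3, y3, y2, y1]
    linear_combination 6 * θ f * e1 + 2 * f * e2 - 2 * PowerSeries.X * f * θ (θ f) * half
  have := congrArg (PowerSeries.coeff (n + 1)) key
  simp only [PowerSeries.coeff_succ_X_mul, hθc, map_add, PowerSeries.coeff_C_mul] at this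
  push_cast at this
  obtain rfl : b = 1 / 2 - a := by linarith
  rw [hk] at this
  linear_combination this

theorem ramanujanCoeff_zero (s : ℝ) : ramanujanCoeff s 0 = 1 := by
  simp [ramanujanCoeff, poch_zero]

theorem ramanujanCoeff_succ (s : ℝ) (n : ℕ) :
    ((n : ℝ) + 1) ^ 3 * ramanujanCoeff s (n + 1)
      = (n + 1 / 2) * (n + s) * (n + (1 - s)) * ramanujanCoeff s n := by
  have : (n.factorial : ℝ) ≠ 0 := by positivity
  simp only [ramanujanCoeff, poch_succ, Nat.factorial_succ]
  push_cast
  field_simp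
  ring

/-- Both sequences start at 1 and obey the same first-order recurrence, since 2 (s/2) = s and 2
((1-s)/2) = 1 - s. -/
theorem ramanujanCoeff_eq_coeff_sq (s : ℝ) (n : ℕ) :
    ramanujanCoeff s n
      = PowerSeries.coeff n (PowerSeries.mk (gaussCoeff (s / 2) ((1 - s) / 2)) ^ 2) := by
  induction n with
  | zero => simp [ramanujanCoeff_zero, gaussCoeff_zero]
  | succ n ih =>
    have h1 := ramanujanCoeff_succ s n
    have h2 := coeff_sq_gaussCoeff_succ (a := s / 2) (b := (1 - s) / 2) (by ring) n
    rw [← ih] at h2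
    have h3 : ((n : ℝ) + 1) ^ 3 ≠ 0 := by positivity
    refine mul_left_cancel₀ h3 ?_
    rw [h1, h2]
    ring

/-- Clausen's formula for functions: the Cauchy product of an absolutely convergent series with
itself. -/
theorem hasSum_ramanujanCoeff {s X : ℝ} (hs : 0 < s) (hs1 : s < 1) (hX : |X| < 1) :
    HasSum (fun n => ramanujanCoeff s n * X ^ n) (gaussF (s / 2) ((1 - s) / 2) X ^ 2) := by
  have hc := gaussCoeff_polyBounded (a := s / 2) (b := (1 - s) / 2) (by linarith) (by linarith)
    (by linarith) (by linarith)
  have hsum := (hc.summable hX).norm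
  have h := summable_norm_sum_mul_antidiagonal_of_summable_norm hsum hsum
  have h2 := tsum_mul_tsum_eq_tsum_sum_antidiagonal_of_summable_norm hsum hsum
  have h3 : ∀ n, ramanujanCoeff s n * X ^ n = ∑ kl ∈ Finset.HasAntidiagonal.antidiagonal n,
      gaussCoeff (s / 2) ((1 - s) / 2) kl.1 * X ^ kl.1 *
        (gaussCoeff (s / 2) ((1 - s) / 2) kl.2 * X ^ kl.2) := fun n => by
    rw [ramanujanCoeff_eq_coeff_sq, sq, PowerSeries.coeff_mul, Finset.sum_mul]
    refine Finset.sum_congr rfl fun kl hkl => ?_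
    rw [← Finset.HasAntidiagonal.mem_antidiagonal.1 hkl, pow_add, PowerSeries.coeff_mk, PowerSeries.coeff_mk]
    ring
  rw [funext h3, sq, gaussF, h2]
  exact h.of_norm.hasSum

theorem ramanujanCoeff_polyBounded {s : ℝ} (hs : 0 < s) (hs1 : s < 1) :
    PolyBounded (ramanujanCoeff s) := by
  refine ⟨1, 0, fun n => ?_⟩
  have p1 := poch_pos (by norm_num : (0 : ℝ) < 1 / 2) n
  have p2 := poch_pos hs n
  have p3 := poch_pos (by linarith : 0 < 1 - s) n
  have h1 := poch_le_factorial (by norm_num : (0 : ℝ) < 1 / 2) (by norm_num) n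
  have h2 := poch_le_factorial hs hs1.le n
  have h3 := poch_le_factorial (by linarith : 0 < 1 - s) (by linarith) n
  have : (0 : ℝ) < n.factorial := by positivity
  unfold ramanujanCoeff
  rw [abs_of_pos (by positivity), pow_zero, mul_one, div_le_one (by positivity)]
  calc poch (1 / 2) n * poch s n * poch (1 - s) n
      ≤ n.factorial * n.factorial * n.factorial := by gcongr
    _ = (n.factorial : ℝ) ^ 3 := by ring

/-- X d/dX applied to Clausen's formula, the series being differentiated term by term. -/
theorem hasSum_mul_ramanujanCoeff {s X : ℝ} (hs : 0 < s) (hs1 : s < 1) (hX : |X| < 1) :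
    HasSum (fun n : ℕ => n * ramanujanCoeff s n * X ^ n)
      (X * (2 * gaussF (s / 2) ((1 - s) / 2) X * gaussF' (s / 2) ((1 - s) / 2) X)) := by
  have hc := ramanujanCoeff_polyBounded hs hs1
  have h1 := hc.hasDerivAt hX
  have h2 := (hasDerivAt_gaussF (a := s / 2) (b := (1 - s) / 2) (by linarith) (by linarith)
    (by linarith) (by linarith) hX).pow 2
  have h3 : (fun x => ∑' n, ramanujanCoeff s n * x ^ n) =ᶠ[𝓝 X]
      (gaussF (s / 2) ((1 - s) / 2)) ^ 2 := by
    filter_upwards [(isOpen_lt continuous_abs continuous_const).mem_nhds hX] with x hx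
    exact (hasSum_ramanujanCoeff hs hs1 hx).tsum_eq
  have h4 := (h2.congr_of_eventuallyEq h3).unique h1
  have h5 := (hc.derivCoeff.summable hX).hasSum
  rw [← h4] at h5
  have h6 : HasSum (fun n : ℕ => n * ramanujanCoeff s n * X ^ n) _ :=
    h5.of_shift (t := X) (by simp) fun n => by
      simp only [derivCoeff]
      push_cast
      ring
  convert h6 using 2
  simp

/-! ### Behaviour of `₂F₁(a, b; 1; t)` at `t = 1` -/

/-- The binomial series. -/
theorem hasSum_poch_div_factorial (α : ℝ) {t : ℝ} (ht : |t| < 1) :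
    HasSum (fun n : ℕ => poch α n / n.factorial * t ^ n) ((1 - t) ^ (-α)) := by
  have h := (Real.one_div_one_sub_rpow_hasFPowerSeriesOnBall_zero α).hasSum (y := t)
    (by simpa [enorm_eq_nnnorm, ← NNReal.coe_lt_one] using ht)
  have hc : ∀ n : ℕ, Ring.choose (α + n - 1) n = poch α n / n.factorial := fun n => by
    have h1 := Ring.factorial_nsmul_multichoose_eq_ascPochhammer α n
    rw [Polynomial.ascPochhammer_smeval_eq_eval] at h1
    rw [Ring.choose, poch, ← h1, show α + n - 1 - n + 1 = α by ring]
    have : (n.factorial : ℝ) ≠ 0 := by positivity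
    simp
    field_simp
  rw [zero_add, one_div, ← Real.rpow_neg (by linarith [(abs_lt.1 ht).2])] at h
  convert! h using 2 with n
  simp [hc, mul_comm]

theorem poch_eq_Gamma_div {s : ℝ} (hs : 0 < s) (n : ℕ) :
    poch s n = Real.Gamma (s + n) / Real.Gamma s := by
  have h := (Real.Gamma_pos_of_pos hs).ne'
  induction n with
  | zero => simp [poch_zero, h]
  | succ n ih =>
    rw [poch_succ, ih]
    push_cast
    rw [← add_assoc, Real.Gamma_add_one (by positivity)]
    ring

/-- The beta density has total mass one; its normalizing constant is cleared. -/
theorem lintegral_beta {α β : ℝ} (hα : 0 < α) (hβ : 0 < β) :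
    ∫⁻ x in Ioo (0 : ℝ) 1, ENNReal.ofReal (x ^ (α - 1) * (1 - x) ^ (β - 1))
      = ENNReal.ofReal (ProbabilityTheory.beta α β) := by
  have hb := ProbabilityTheory.beta_pos hα hβ
  have h := ProbabilityTheory.lintegral_betaPDF_eq_one hα hβ
  rw [ProbabilityTheory.lintegral_betaPDF] at h
  have h2 : ∀ x : ℝ, ENNReal.ofReal (1 / ProbabilityTheory.beta α β * x ^ (α - 1) *
      (1 - x) ^ (β - 1)) = ENNReal.ofReal (1 / ProbabilityTheory.beta α β) *
        ENNReal.ofReal (x ^ (α - 1) * (1 - x) ^ (β - 1)) := fun x => by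
    rw [mul_assoc, ENNReal.ofReal_mul (by positivity)]
  simp_rw [h2] at h
  rw [MeasureTheory.lintegral_const_mul _ (by fun_prop)] at h
  calc _ = ENNReal.ofReal (ProbabilityTheory.beta α β) *
        (ENNReal.ofReal (1 / ProbabilityTheory.beta α β) * ∫⁻ x in Ioo (0 : ℝ) 1,
          ENNReal.ofReal (x ^ (α - 1) * (1 - x) ^ (β - 1))) := by
        rw [← mul_assoc, ← ENNReal.ofReal_mul hb.le, mul_one_div_cancel hb.ne',
          ENNReal.ofReal_one, one_mul]
    _ = _ := by rw [h, mul_one]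

/-- Gauss's summation theorem for `₂F₁(a, b; 1; 1)`. -/
theorem hasSum_gaussCoeff {a b : ℝ} (ha : 0 < a) (hb : 0 < b) (hab : a + b < 1) :
    HasSum (gaussCoeff a b)
      (Real.Gamma (1 - a - b) / (Real.Gamma (1 - a) * Real.Gamma (1 - b))) := by
  have gb := Real.Gamma_pos_of_pos hb
  have gb1 := Real.Gamma_pos_of_pos (by linarith : 0 < 1 - b)
  have ga1 := Real.Gamma_pos_of_pos (by linarith : 0 < 1 - a)
  have gab := Real.Gamma_pos_of_pos (by linarith : 0 < 1 - a - b)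
  set K := Real.Gamma b * Real.Gamma (1 - b) with hK
  have hKpos : 0 < K := by positivity
  -- Euler's integral: Γ(b)Γ(1-b) (b)_n / n! is the beta integral with parameters b + n and 1 - b.
  have term : ∀ n : ℕ, ENNReal.ofReal (K * gaussCoeff a b n) = ∫⁻ x in Ioo (0 : ℝ) 1,
      ENNReal.ofReal (poch a n / n.factorial * x ^ n * (x ^ (b - 1) * (1 - x) ^ (1 - b - 1))) := by
    intro n
    have hp := poch_pos ha n
    have hn : (0 : ℝ) < n.factorial := by positivity
    have h := lintegral_beta (α := b + n) (β := 1 - b) (by positivity) (by linarith)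
    have e : ∀ x ∈ Ioo (0 : ℝ) 1, ENNReal.ofReal (poch a n / n.factorial * x ^ n *
        (x ^ (b - 1) * (1 - x) ^ (1 - b - 1))) = ENNReal.ofReal (poch a n / n.factorial) *
          ENNReal.ofReal (x ^ (b + n - 1) * (1 - x) ^ (1 - b - 1)) := fun x hx => by
      rw [← ENNReal.ofReal_mul (by positivity), show b + n - 1 = n + (b - 1) by ring,
        Real.rpow_add hx.1, Real.rpow_natCast]
      ring_nf
    rw [MeasureTheory.setLIntegral_congr_fun measurableSet_Ioo e,
      MeasureTheory.lintegral_const_mul _ (by fun_prop), h, ← ENNReal.ofReal_mul (by positivity),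
      gaussCoeff, poch_eq_Gamma_div hb, ProbabilityTheory.beta, hK,
      show b + n + (1 - b) = n + 1 by ring, Real.Gamma_nat_eq_factorial]
    congr 1
    field_simp
  -- All terms are nonnegative, so sum and integral may be interchanged. The binomial series
  -- contributes (1-x)^(-a), leaving the beta integral with parameters b and 1 - a - b. Its
  -- finiteness is also what proves summability.
  have htsum : ∑' n, ENNReal.ofReal (K * gaussCoeff a b n)
      = ENNReal.ofReal (ProbabilityTheory.beta b (1 - a - b)) := by
    simp_rw [term]
    rw [← MeasureTheory.lintegral_tsum fun n => by fun_prop,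
      ← lintegral_beta hb (by linarith : 0 < 1 - a - b)]
    refine MeasureTheory.setLIntegral_congr_fun measurableSet_Ioo fun x hx => ?_
    have hx1 : 0 < 1 - x := by linarith [hx.2]
    have h1 := (hasSum_poch_div_factorial a (t := x) (by rw [abs_of_pos hx.1]; exact hx.2)).mul_right
      (x ^ (b - 1) * (1 - x) ^ (1 - b - 1))
    have hnn : ∀ n : ℕ, 0 ≤ poch a n / n.factorial * x ^ n *
        (x ^ (b - 1) * (1 - x) ^ (1 - b - 1)) := fun n => by
      have hp := poch_pos ha n
      have := hx.1
      positivity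
    rw [← ENNReal.ofReal_tsum_of_nonneg hnn h1.summable, h1.tsum_eq,
      show 1 - a - b - 1 = -a + (1 - b - 1) by ring, Real.rpow_add hx1]
    ring_nf
  have hnn : ∀ n, 0 ≤ K * gaussCoeff a b n := fun n =>
    (mul_pos hKpos (gaussCoeff_pos ha hb n)).le
  have hs : Summable fun n => K * gaussCoeff a b n := by
    have h := ENNReal.summable_toReal (htsum ▸ ENNReal.ofReal_ne_top)
    refine h.congr fun n => ENNReal.toReal_ofReal (hnn n)
  have h1 : ∑' n, K * gaussCoeff a b n = ProbabilityTheory.beta b (1 - a - b) := by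
    rw [← ENNReal.ofReal_tsum_of_nonneg hnn hs] at htsum
    exact (ENNReal.ofReal_eq_ofReal_iff (tsum_nonneg hnn)
      (ProbabilityTheory.beta_pos hb (by linarith)).le).1 htsum
  have h2 := (h1 ▸ hs.hasSum).mul_left K⁻¹
  rw [ProbabilityTheory.beta, hK, show b + (1 - a - b) = 1 - a by ring] at h2
  convert! h2 using 1
  · funext n
    field_simp
  · field_simp

/-- Abel's limit theorem applied to Gauss's sum. -/
theorem tendsto_gaussF_one {a b : ℝ} (ha : 0 < a) (hb : 0 < b) (hab : a + b < 1) :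
    Tendsto (gaussF a b) (𝓝[<] 1)
      (𝓝 (Real.Gamma (1 - a - b) / (Real.Gamma (1 - a) * Real.Gamma (1 - b)))) :=
  Real.tendsto_tsum_powerSeries_nhdsWithin_lt (hasSum_gaussCoeff ha hb hab).tendsto_sum_nat

/-- An Abelian theorem: if `d n / e n → L` with `e n > 0` and `∑ e n t ^ n → ∞` as `t → 1⁻`, then
`(∑ d n t ^ n) / (∑ e n t ^ n) → L`. -/
theorem tendsto_tsum_div_tsum_of_tendsto_div {d e : ℕ → ℝ} {L : ℝ} (he : ∀ n, 0 < e n)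
    (hde : Tendsto (fun n => d n / e n) atTop (𝓝 L))
    (hd : ∀ t : ℝ, |t| < 1 → Summable fun n => d n * t ^ n)
    (hes : ∀ t : ℝ, |t| < 1 → Summable fun n => e n * t ^ n)
    (htop : Tendsto (fun t : ℝ => ∑' n, e n * t ^ n) (𝓝[<] 1) atTop) :
    Tendsto (fun t : ℝ => (∑' n, d n * t ^ n) / ∑' n, e n * t ^ n) (𝓝[<] 1) (𝓝 L) := by
  rw [Metric.tendsto_nhds]
  intro ε hε
  obtain ⟨N, hN⟩ := eventually_atTop.1 ((Metric.tendsto_nhds.1 hde) (ε / 2) (by positivity))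
  -- M bounds the contribution of the first N terms uniformly in t; once E exceeds 2M/ε it costs
  -- less than ε/2 after division by E.
  set M := ∑ n ∈ Finset.range N, |d n - L * e n| with hM
  have hM0 : 0 ≤ M := Finset.sum_nonneg fun _ _ => abs_nonneg _
  have hIoo : Ioo (0 : ℝ) 1 ∈ 𝓝[<] (1 : ℝ) := Ioo_mem_nhdsLT one_pos
  filter_upwards [hIoo, htop.eventually_gt_atTop (2 * M / ε)] with t ht htE
  have ht1 : |t| < 1 := by rw [abs_of_pos ht.1]; exact ht.2
  set E := ∑' n, e n * t ^ n with hE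
  have hE0 : 0 < E := lt_of_le_of_lt (by positivity) htE
  have hdiff : (∑' n, d n * t ^ n) - L * E = ∑' n, (d n - L * e n) * t ^ n := by
    rw [hE, ← tsum_mul_left, ← (hd t ht1).tsum_sub ((hes t ht1).mul_left L)]
    refine tsum_congr fun n => by ring
  have hb : ∀ n, |(d n - L * e n) * t ^ n| ≤
      (if n < N then |d n - L * e n| else 0) + ε / 2 * (e n * t ^ n) := by
    intro n
    have htn : 0 ≤ t ^ n := pow_nonneg ht.1.le n
    have htn1 : t ^ n ≤ 1 := pow_le_one₀ ht.1.le ht.2.le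
    have hen := he n
    rw [abs_mul, abs_of_nonneg htn]
    split_ifs with h
    · have : |d n - L * e n| * t ^ n ≤ |d n - L * e n| := mul_le_of_le_one_right (abs_nonneg _) htn1
      have : 0 ≤ ε / 2 * (e n * t ^ n) := by positivity
      linarith
    · have h1 := hN n (not_lt.1 h)
      rw [Real.dist_eq] at h1
      have h2 : |d n - L * e n| ≤ ε / 2 * e n := by
        rw [show d n - L * e n = (d n / e n - L) * e n by field_simp, abs_mul, abs_of_pos hen]
        gcongr
      rw [zero_add, ← mul_assoc]
      gcongr
  have hfin : HasSum (fun n => if n < N then |d n - L * e n| else 0) M := by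
    rw [hM, Finset.sum_congr rfl fun n hn => (if_pos (Finset.mem_range.1 hn)).symm]
    exact hasSum_sum_of_ne_finset_zero fun n hn => if_neg (by simpa using hn)
  have hsum := hfin.add (((hes t ht1).hasSum).mul_left (ε / 2))
  have habs : |∑' n, (d n - L * e n) * t ^ n| ≤ M + ε / 2 * E := by
    rw [← Real.norm_eq_abs]
    exact tsum_of_norm_bounded hsum hb
  rw [Real.dist_eq, show (∑' n, d n * t ^ n) / E - L = ((∑' n, d n * t ^ n) - L * E) / E by
    field_simp, hdiff, abs_div, abs_of_pos hE0, div_lt_iff₀ hE0]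
  have : M < ε / 2 * E := by
    rw [div_lt_iff₀ hε] at htE
    linarith
  linarith

/-- Euler's product for Γ has n + 1 factors in its denominator, hence the index n + 1. -/
theorem poch_succ_eq_div_GammaSeq {s : ℝ} (hs : 0 < s) (n : ℕ) :
    poch s (n + 1) * Real.GammaSeq s n = (n : ℝ) ^ s * n.factorial := by
  have := (poch_pos hs (n + 1)).ne'
  rw [Real.GammaSeq, ← poch_eq_prod]
  field_simp

/-- The derivative of `₂F₁(a, b; 1; t)` is asymptotic to
`Γ(a + b) / (Γ(a) Γ(b)) * (1 - t) ^ (-(a + b))` as `t → 1⁻`. -/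
theorem tendsto_gaussF'_one {a b : ℝ} (ha : 0 < a) (ha1 : a ≤ 1) (hb : 0 < b) (hb1 : b ≤ 1) :
    Tendsto (fun t => (1 - t) ^ (a + b) * gaussF' a b t) (𝓝[<] 1)
      (𝓝 (Real.Gamma (a + b) / (Real.Gamma a * Real.Gamma b))) := by
  have hab : 0 < a + b := by linarith
  have ga := (Real.Gamma_pos_of_pos ha).ne'
  have gb := (Real.Gamma_pos_of_pos hb).ne'
  -- The comparison series is (1-t)^(-(a+b)), with coefficients (a+b)_n / n!.
  have hratio : Tendsto (fun n : ℕ => derivCoeff (gaussCoeff a b) n /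
      (poch (a + b) n / n.factorial)) atTop
      (𝓝 (Real.Gamma (a + b) / (Real.Gamma a * Real.Gamma b))) := by
    -- Euler's product for Γ(a+b) involves (a+b)_(n+1) rather than (a+b)_n; this is the leftover
    -- factor (n+a+b)/(n+1).
    have h1 : Tendsto (fun n : ℕ => 1 + (a + b - 1) / ((n : ℝ) + 1)) atTop (𝓝 (1 + 0)) :=
      tendsto_const_nhds.add (tendsto_const_nhds.div_atTop
        (tendsto_atTop_add_const_right _ _ tendsto_natCast_atTop_atTop))
    have h2 := (((Real.GammaSeq_tendsto_Gamma (a + b)).div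
      ((Real.GammaSeq_tendsto_Gamma a).mul (Real.GammaSeq_tendsto_Gamma b))
      (mul_ne_zero ga gb)).mul h1)
    rw [add_zero, mul_one] at h2
    refine h2.congr' ?_
    filter_upwards [eventually_gt_atTop 0] with n hn
    have hn' : (0 : ℝ) < n := by exact_mod_cast hn
    have ea := poch_succ_eq_div_GammaSeq ha n
    have eb := poch_succ_eq_div_GammaSeq hb n
    have eab := poch_succ_eq_div_GammaSeq hab n
    have pa := poch_pos ha (n + 1)
    have pb := poch_pos hb (n + 1)
    have pab := poch_pos hab n
    rw [poch_succ, Real.rpow_add hn'] at eab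
    have fa : Real.GammaSeq a n = (n : ℝ) ^ a * n.factorial / poch a (n + 1) := by
      rw [← ea]; field_simp
    have fb : Real.GammaSeq b n = (n : ℝ) ^ b * n.factorial / poch b (n + 1) := by
      rw [← eb]; field_simp
    have fab : Real.GammaSeq (a + b) n
        = (n : ℝ) ^ a * (n : ℝ) ^ b * n.factorial / (poch (a + b) n * (a + b + n)) := by
      rw [← eab]; field_simp
    simp only [Pi.div_apply]
    rw [fa, fb, fab, derivCoeff, gaussCoeff, Nat.factorial_succ]
    have := Real.rpow_pos_of_pos hn' a
    have := Real.rpow_pos_of_pos hn' b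
    push_cast
    field_simp
    ring
  have hbin : ∀ t : ℝ, |t| < 1 → Summable fun n : ℕ => poch (a + b) n / n.factorial * t ^ n :=
    fun t ht => (hasSum_poch_div_factorial (a + b) ht).summable
  have hIoo : Ioo (0 : ℝ) 1 ∈ 𝓝[<] (1 : ℝ) := Ioo_mem_nhdsLT one_pos
  have htop : Tendsto (fun t : ℝ => ∑' n : ℕ, poch (a + b) n / n.factorial * t ^ n) (𝓝[<] 1)
      atTop := by
    have h0 : Tendsto (fun t : ℝ => 1 - t) (𝓝[<] 1) (𝓝[>] 0) := by
      refine tendsto_nhdsWithin_iff.2 ⟨?_, ?_⟩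
      · have : Tendsto (fun t : ℝ => 1 - t) (𝓝 1) (𝓝 (1 - 1)) := by
          exact (continuous_const.sub continuous_id).tendsto 1
        rw [sub_self] at this
        exact this.mono_left nhdsWithin_le_nhds
      · filter_upwards [self_mem_nhdsWithin] with t ht
        exact sub_pos.2 (mem_Iio.1 ht)
    refine ((tendsto_rpow_neg_nhdsGT_zero (y := -(a + b)) (by linarith)).comp h0).congr' ?_
    filter_upwards [hIoo] with t ht
    exact (hasSum_poch_div_factorial (a + b) (by rw [abs_of_pos ht.1]; exact ht.2)).tsum_eq.symm
  have key := tendsto_tsum_div_tsum_of_tendsto_div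
    (fun n => div_pos (poch_pos hab n) (by positivity)) hratio
    (fun t ht => (gaussCoeff_polyBounded ha ha1 hb hb1).derivCoeff.summable ht) hbin htop
  refine key.congr' ?_
  filter_upwards [hIoo] with t ht
  rw [(hasSum_poch_div_factorial (a + b) (by rw [abs_of_pos ht.1]; exact ht.2)).tsum_eq,
    Real.rpow_neg (by linarith [ht.2]), gaussF', div_inv_eq_mul, mul_comm]

/-- The product of the value and of the leading coefficient of the derivative at `1`. -/
theorem Gamma_div_mul_Gamma_div {a b : ℝ} (ha : 0 < a) (hb : 0 < b) (hab : a + b < 1) :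
    Real.Gamma (1 - a - b) / (Real.Gamma (1 - a) * Real.Gamma (1 - b)) *
      (Real.Gamma (a + b) / (Real.Gamma a * Real.Gamma b))
      = Real.sin (Real.pi * a) * Real.sin (Real.pi * b) /
        (Real.pi * Real.sin (Real.pi * (a + b))) := by
  have ea := Real.Gamma_mul_Gamma_one_sub a
  have eb := Real.Gamma_mul_Gamma_one_sub b
  have eab := Real.Gamma_mul_Gamma_one_sub (a + b)
  have sa := Real.sin_pos_of_pos_of_lt_pi (mul_pos Real.pi_pos ha)
    (by nlinarith [Real.pi_pos])
  have sb := Real.sin_pos_of_pos_of_lt_pi (mul_pos Real.pi_pos hb)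
    (by nlinarith [Real.pi_pos])
  have hpi := Real.pi_pos
  rw [show 1 - a - b = 1 - (a + b) by ring]
  -- Three reflection formulas: one π above, two below, so a single 1/π survives.
  calc _ = (Real.Gamma (a + b) * Real.Gamma (1 - (a + b))) /
        ((Real.Gamma a * Real.Gamma (1 - a)) * (Real.Gamma b * Real.Gamma (1 - b))) := by
        rw [div_mul_div_comm]; congr 1 <;> ring
    _ = _ := by
        rw [ea, eb, eab]
        field_simp

/-! ### Algebraic transformations of hypergeometric functions -/

/-- The derivative is required only in the interior because the differential equations below are
singular at p = 0. -/
theorem eq_of_hasDerivAt_zero {f : ℝ → ℝ} {x y : ℝ} (hxy : x < y) (hf : ContinuousOn f (Icc x y))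
    (hf' : ∀ z ∈ Ioo x y, HasDerivAt f 0 z) : f y = f x := by
  obtain ⟨c, -, hc⟩ := exists_hasDerivAt_eq_slope f (fun _ => 0) hxy hf hf'
  rw [eq_comm, div_eq_zero_iff, or_iff_left (sub_pos.2 hxy).ne'] at hc
  exact sub_eq_zero.1 hc

/-- Data for an identity `₂F₁(s / 2, (1 - s) / 2; 1; X p) = m p * ₂F₁(a, b; 1; T p)` on an interval
`[0, p₀)` with `T p₀ = 1`. Here `X₁`, `T₁` are the derivatives of `X`, `T`, while `ℓX`, `ℓT`, `μ`,
`lam` are the logarithmic derivatives of `X₁`, `T₁`, `m`, `r`. The last three fields say that both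
sides are solutions of one differential equation, whose Wronskian is a multiple of
`1 / (p * r p)`. -/
structure GaussTransformation (s a b p₀ : ℝ) where
  (X T X₁ T₁ m μ μ₁ r lam ℓX ℓT A B : ℝ → ℝ)
  hs : 0 < s
  hs1 : s < 1
  ha : 0 < a
  hb : 0 < b
  hab : a + b < 1
  hp₀ : 0 < p₀
  X_zero : X 0 = 0
  T_zero : T 0 = 0
  m_zero : m 0 = 1
  T_end : T p₀ = 1
  X_mem : ∀ p ∈ Icc 0 p₀, |X p| < 1
  T_mem : ∀ p ∈ Ioo 0 p₀, T p ∈ Ioo (0 : ℝ) 1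
  m_pos : ∀ p ∈ Icc 0 p₀, 0 < m p
  hX : ∀ p ∈ Icc 0 p₀, HasDerivAt X (X₁ p) p
  hT : ∀ p ∈ Icc 0 p₀, HasDerivAt T (T₁ p) p
  hm : ∀ p ∈ Icc 0 p₀, HasDerivAt m (m p * μ p) p
  hμ : ∀ p ∈ Icc 0 p₀, HasDerivAt μ (μ₁ p) p
  hr : ∀ p ∈ Icc 0 p₀, HasDerivAt r (r p * lam p) p
  X₁_cont : ∀ p ∈ Icc 0 p₀, ContinuousAt X₁ p
  T₁_cont : ∀ p ∈ Icc 0 p₀, ContinuousAt T₁ p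
  r_ne : ∀ p ∈ Ioo 0 p₀, r p ≠ 0
  hX₁ : ∀ p ∈ Ioo 0 p₀, HasDerivAt X₁ (X₁ p * ℓX p) p
  hT₁ : ∀ p ∈ Ioo 0 p₀, HasDerivAt T₁ (T₁ p * ℓT p) p
  X₁_eq : ∀ p ∈ Ioo 0 p₀, X₁ p = A p * (X p * (1 - X p))
  T₁_eq : ∀ p ∈ Ioo 0 p₀, T₁ p = B p * (T p * (1 - T p))
  -- The common equation is y'' + (1/p + lam) y' = (s(1-s)/4) X₁ A y. `ode_X` gives it for y = F(X);
  -- for y = m g(T), `ode_T` and `ode_m` match the coefficients of g' and g. Given X and T, `ode_X`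
  -- forces r and `ode_T` forces m up to constants, so `ode_m` is the real condition.
  ode_X : ∀ p ∈ Ioo 0 p₀, 1 / p + lam p + ℓX p = A p * (1 - 3 / 2 * X p)
  ode_T : ∀ p ∈ Ioo 0 p₀, 1 / p + lam p + 2 * μ p + ℓT p = B p * (1 - (a + b + 1) * T p)
  ode_m : ∀ p ∈ Ioo 0 p₀, (1 / p + lam p + μ p) * μ p + μ₁ p + a * b * (T₁ p * B p)
    = s * (1 - s) / 4 * (X₁ p * A p)

namespace GaussTransformation

variable {s a b p₀ : ℝ} (D : GaussTransformation s a b p₀)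

/-- The Wronskian of the two sides, normalized to be constant. -/
noncomputable def wronskian (p : ℝ) : ℝ :=
  p * D.r p * D.m p * (gaussF (s / 2) ((1 - s) / 2) (D.X p) *
    (D.μ p * gaussF a b (D.T p) + gaussF' a b (D.T p) * D.T₁ p)
    - gaussF' (s / 2) ((1 - s) / 2) (D.X p) * D.X₁ p * gaussF a b (D.T p))

theorem abs_T_lt_one {p : ℝ} (hp : p ∈ Ico 0 p₀) : |D.T p| < 1 := by
  rcases hp.1.eq_or_lt with rfl | h
  · simp [D.T_zero]
  · have := D.T_mem p ⟨h, hp.2⟩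
    rw [abs_of_pos this.1]
    exact this.2

theorem hasDerivAt_gaussF_T {p : ℝ} (hp : p ∈ Ico 0 p₀) :
    HasDerivAt (gaussF a b) (gaussF' a b (D.T p)) (D.T p) :=
  hasDerivAt_gaussF D.ha (by linarith [D.hb, D.hab]) D.hb (by linarith [D.ha, D.hab])
    (D.abs_T_lt_one hp)

theorem hasDerivAt_gaussF'_T {p : ℝ} (hp : p ∈ Ico 0 p₀) :
    HasDerivAt (gaussF' a b) (gaussF'' a b (D.T p)) (D.T p) :=
  hasDerivAt_gaussF' D.ha (by linarith [D.hb, D.hab]) D.hb (by linarith [D.ha, D.hab])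
    (D.abs_T_lt_one hp)

theorem hasDerivAt_gaussF_X {p : ℝ} (hp : p ∈ Icc 0 p₀) :
    HasDerivAt (gaussF (s / 2) ((1 - s) / 2)) (gaussF' (s / 2) ((1 - s) / 2) (D.X p)) (D.X p) :=
  hasDerivAt_gaussF (by linarith [D.hs]) (by linarith [D.hs1]) (by linarith [D.hs1])
    (by linarith [D.hs]) (D.X_mem p hp)

theorem hasDerivAt_gaussF'_X {p : ℝ} (hp : p ∈ Icc 0 p₀) :
    HasDerivAt (gaussF' (s / 2) ((1 - s) / 2)) (gaussF'' (s / 2) ((1 - s) / 2) (D.X p)) (D.X p) :=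
  hasDerivAt_gaussF' (by linarith [D.hs]) (by linarith [D.hs1]) (by linarith [D.hs1])
    (by linarith [D.hs]) (D.X_mem p hp)

theorem continuousAt_wronskian {p : ℝ} (hp : p ∈ Ico 0 p₀) : ContinuousAt D.wronskian p := by
  have hp' : p ∈ Icc 0 p₀ := Ico_subset_Icc_self hp
  have cX := (D.hX p hp').continuousAt
  have cT := (D.hT p hp').continuousAt
  have c1 : ContinuousAt (fun q => gaussF (s / 2) ((1 - s) / 2) (D.X q)) p :=
    (D.hasDerivAt_gaussF_X hp').continuousAt.comp cX
  have c2 : ContinuousAt (fun q => gaussF' (s / 2) ((1 - s) / 2) (D.X q)) p :=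
    (D.hasDerivAt_gaussF'_X hp').continuousAt.comp cX
  have c3 : ContinuousAt (fun q => gaussF a b (D.T q)) p :=
    (D.hasDerivAt_gaussF_T hp).continuousAt.comp cT
  have c4 : ContinuousAt (fun q => gaussF' a b (D.T q)) p :=
    (D.hasDerivAt_gaussF'_T hp).continuousAt.comp cT
  exact ((continuousAt_id.mul (D.hr p hp').continuousAt).mul (D.hm p hp').continuousAt).mul
    ((c1.mul (((D.hμ p hp').continuousAt.mul c3).add (c4.mul (D.T₁_cont p hp')))).sub
      ((c2.mul (D.X₁_cont p hp')).mul c3))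

/-- Abel's identity: the Wronskian of two solutions satisfies W' = -(1/p + lam) W, and p r has
logarithmic derivative 1/p + lam. -/
theorem hasDerivAt_wronskian {p : ℝ} (hp : p ∈ Ioo 0 p₀) : HasDerivAt D.wronskian 0 p := by
  have hp1 : p ∈ Icc 0 p₀ := Ioo_subset_Icc_self hp
  have hp2 : p ∈ Ico 0 p₀ := Ioo_subset_Ico_self hp
  have d1 := (D.hasDerivAt_gaussF_X hp1).comp p (D.hX p hp1)
  have d2 := (D.hasDerivAt_gaussF'_X hp1).comp p (D.hX p hp1)
  have d3 := (D.hasDerivAt_gaussF_T hp2).comp p (D.hT p hp1)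
  have d4 := (D.hasDerivAt_gaussF'_T hp2).comp p (D.hT p hp1)
  have d := (((hasDerivAt_id p).mul (D.hr p hp1)).mul (D.hm p hp1)).mul
    ((d1.mul (((D.hμ p hp1).mul d3).add (d4.mul (D.hT₁ p hp)))).sub
      ((d2.mul (D.hX₁ p hp)).mul d3))
  refine HasDerivAt.congr_deriv (f := D.wronskian) d ?_
  have oX := gaussF_ode (a := s / 2) (b := (1 - s) / 2) (by linarith [D.hs]) (by linarith [D.hs1])
    (by linarith [D.hs1]) (by linarith [D.hs]) (D.X_mem p hp1)
  have oT := gaussF_ode D.ha (by linarith [D.hb, D.hab]) D.hb (by linarith [D.ha, D.hab])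
    (D.abs_T_lt_one hp2)
  have e1 := D.ode_X p hp
  have e2 := D.ode_T p hp
  have e3 := D.ode_m p hp
  have hX₁ := D.X₁_eq p hp
  have hT₁ := D.T₁_eq p hp
  have hpp : p * (1 / p) = 1 := mul_one_div_cancel hp.1.ne'
  simp only [Function.comp, Pi.mul_apply, Pi.add_apply, Pi.sub_apply, id]
  generalize gaussF (s / 2) ((1 - s) / 2) (D.X p) = f at *
  generalize gaussF' (s / 2) ((1 - s) / 2) (D.X p) = f' at *
  generalize gaussF'' (s / 2) ((1 - s) / 2) (D.X p) = f'' at *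
  generalize gaussF a b (D.T p) = g at *
  generalize gaussF' a b (D.T p) = g' at *
  generalize gaussF'' a b (D.T p) = g'' at *
  generalize D.X p = x at *
  generalize D.T p = t at *
  generalize D.X₁ p = x' at *
  generalize D.T₁ p = t' at *
  generalize D.A p = A at *
  generalize D.B p = B at *
  generalize D.ℓX p = lx at *
  generalize D.ℓT p = lt at *
  generalize D.μ p = μ at *
  generalize D.μ₁ p = μ' at *
  generalize D.lam p = l at *
  generalize D.m p = m at *
  generalize D.r p = r at *
  generalize 1 / p = q at *
  have oX' : f'' * x' = A * (s * (1 - s) / 4 * f - (1 - 3 / 2 * x) * f') := by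
    rw [hX₁]; linear_combination A * oX
  have oT' : g'' * t' = B * (a * b * g - (1 - (a + b + 1) * t) * g') := by
    rw [hT₁]; linear_combination B * oT
  -- With w the Wronskian divided by m, this is (1/p + lam + μ) w + w' = 0; the hypergeometric
  -- equations have removed the second derivatives.
  have main : (q + l + μ) * (f * (μ * g + g' * t') - f' * x' * g) +
      (f' * x' * (μ * g + g' * t') + f * (μ' * g + μ * (g' * t') + (g'' * t' * t' + g' * (t' * lt)))
        - ((f'' * x' * x' + f' * (x' * lx)) * g + f' * x' * (g' * t'))) = 0 := by
    rw [oX', oT']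
    linear_combination (-f' * x' * g) * e1 + (f * g' * t') * e2 + f * g * e3
  linear_combination p * r * m * main - r * m * (f * (μ * g + g' * t') - f' * x' * g) * hpp

/-- The factor p vanishes at the singular point 0, so no initial derivatives need to be compared. -/
theorem wronskian_eq_zero {p : ℝ} (hp : p ∈ Ioo 0 p₀) : D.wronskian p = 0 := by
  rw [eq_of_hasDerivAt_zero hp.1
    (fun x hx => (D.continuousAt_wronskian ⟨hx.1, hx.2.trans_lt hp.2⟩).continuousWithinAt)
    fun x hx => D.hasDerivAt_wronskian ⟨hx.1, hx.2.trans hp.2⟩]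
  simp [wronskian]

theorem gaussF_T_pos {p : ℝ} (hp : p ∈ Ico 0 p₀) : 0 < gaussF a b (D.T p) := by
  refine gaussF_pos D.ha (by linarith [D.hb, D.hab]) D.hb (by linarith [D.ha, D.hab]) ?_
    (abs_lt.1 (D.abs_T_lt_one hp)).2
  rcases hp.1.eq_or_lt with rfl | h
  · rw [D.T_zero]
  · exact (D.T_mem p ⟨h, hp.2⟩).1.le

/-- The transformation formula. -/
theorem gaussF_X_eq {p : ℝ} (hp : p ∈ Ico 0 p₀) :
    gaussF (s / 2) ((1 - s) / 2) (D.X p) = D.m p * gaussF a b (D.T p) := by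
  have hmG : ∀ q ∈ Ico 0 p₀, D.m q * gaussF a b (D.T q) ≠ 0 := fun q hq =>
    (mul_pos (D.m_pos q (Ico_subset_Icc_self hq)) (D.gaussF_T_pos hq)).ne'
  have hder : ∀ q ∈ Ico 0 p₀, HasDerivAt
      (fun q => gaussF (s / 2) ((1 - s) / 2) (D.X q) / (D.m q * gaussF a b (D.T q))) _ q :=
    fun q hq => ((D.hasDerivAt_gaussF_X (Ico_subset_Icc_self hq)).comp q
      (D.hX q (Ico_subset_Icc_self hq))).div ((D.hm q (Ico_subset_Icc_self hq)).mul
        ((D.hasDerivAt_gaussF_T hq).comp q (D.hT q (Ico_subset_Icc_self hq)))) (hmG q hq)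
  rcases hp.1.eq_or_lt with rfl | h0
  · rw [D.X_zero, D.T_zero, D.m_zero, gaussF_zero, gaussF_zero, one_mul]
  -- The numerator of the derivative of the quotient is a multiple of the Wronskian, hence zero.
  have key := eq_of_hasDerivAt_zero h0
    (fun q hq => (hder q ⟨hq.1, hq.2.trans_lt hp.2⟩).continuousAt.continuousWithinAt)
    fun q hq => (hder q ⟨hq.1.le, hq.2.trans hp.2⟩).congr_deriv (by
      have hq' : q ∈ Ioo 0 p₀ := ⟨hq.1, hq.2.trans hp.2⟩
      have hW := D.wronskian_eq_zero hq'
      rw [wronskian, mul_eq_zero] at hW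
      have hW' := hW.resolve_left (mul_ne_zero (mul_ne_zero hq.1.ne' (D.r_ne q hq'))
        (D.m_pos q (Ioo_subset_Icc_self hq')).ne')
      rw [div_eq_zero_iff]
      left
      simp only [Function.comp]
      linear_combination -D.m q * hW')
  simp only [D.X_zero, D.T_zero, D.m_zero, gaussF_zero, one_mul, div_one] at key
  rwa [div_eq_one_iff_eq (hmG p hp)] at key

theorem tendsto_T_end : Tendsto D.T (𝓝[<] p₀) (𝓝[<] 1) := by
  refine tendsto_nhdsWithin_iff.2 ⟨?_, ?_⟩
  · have h := (D.hT p₀ (right_mem_Icc.2 D.hp₀.le)).continuousAt.tendsto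
    rw [D.T_end] at h
    exact h.mono_left nhdsWithin_le_nhds
  · filter_upwards [Ioo_mem_nhdsLT D.hp₀] with p hp
    exact (D.T_mem p hp).2

theorem tendsto_gaussF_T_end : Tendsto (fun p => gaussF a b (D.T p)) (𝓝[<] p₀)
    (𝓝 (Real.Gamma (1 - a - b) / (Real.Gamma (1 - a) * Real.Gamma (1 - b)))) :=
  (tendsto_gaussF_one D.ha D.hb D.hab).comp D.tendsto_T_end

/-- The value of `₂F₁(s / 2, (1 - s) / 2; 1; ·)` at the end point. -/
theorem gaussF_X_end : gaussF (s / 2) ((1 - s) / 2) (D.X p₀)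
    = D.m p₀ * (Real.Gamma (1 - a - b) / (Real.Gamma (1 - a) * Real.Gamma (1 - b))) := by
  have hp := right_mem_Icc.2 D.hp₀.le
  have h1 : Tendsto (fun p => gaussF (s / 2) ((1 - s) / 2) (D.X p)) (𝓝[<] p₀)
      (𝓝 (gaussF (s / 2) ((1 - s) / 2) (D.X p₀))) :=
    ((D.hasDerivAt_gaussF_X hp).continuousAt.comp (D.hX p₀ hp).continuousAt).tendsto.mono_left
      nhdsWithin_le_nhds
  have h2 := ((D.hm p₀ hp).continuousAt.tendsto.mono_left nhdsWithin_le_nhds).mul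
    D.tendsto_gaussF_T_end
  refine tendsto_nhds_unique h1 (h2.congr' ?_)
  filter_upwards [Ioo_mem_nhdsLT D.hp₀] with p hp
  exact (D.gaussF_X_eq (Ioo_subset_Ico_self hp)).symm

/-- The derivative of `₂F₁(s / 2, (1 - s) / 2; 1; ·)` at the end point. -/
theorem gaussF'_X_end {κ : ℝ → ℝ} (hκ : ContinuousAt κ p₀)
    (hT₁κ : ∀ p ∈ Ioo 0 p₀, D.T₁ p = κ p * (1 - D.T p) ^ (a + b)) :
    gaussF' (s / 2) ((1 - s) / 2) (D.X p₀) * D.X₁ p₀ = D.m p₀ *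
      (D.μ p₀ * (Real.Gamma (1 - a - b) / (Real.Gamma (1 - a) * Real.Gamma (1 - b))) +
        κ p₀ * (Real.Gamma (a + b) / (Real.Gamma a * Real.Gamma b))) := by
  have hp := right_mem_Icc.2 D.hp₀.le
  have h1 : Tendsto (fun p => gaussF' (s / 2) ((1 - s) / 2) (D.X p) * D.X₁ p) (𝓝[<] p₀)
      (𝓝 (gaussF' (s / 2) ((1 - s) / 2) (D.X p₀) * D.X₁ p₀)) :=
    (((D.hasDerivAt_gaussF'_X hp).continuousAt.comp (D.hX p₀ hp).continuousAt).mul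
      (D.X₁_cont p₀ hp)).tendsto.mono_left nhdsWithin_le_nhds
  -- The zero of T₁ at p₀, of the exact rate (1-T)^(a+b), compensates the blow-up of g'(T).
  have h2 := ((D.hm p₀ hp).continuousAt.tendsto.mono_left nhdsWithin_le_nhds).mul
    ((((D.hμ p₀ hp).continuousAt.tendsto.mono_left nhdsWithin_le_nhds).mul
      D.tendsto_gaussF_T_end).add ((hκ.tendsto.mono_left nhdsWithin_le_nhds).mul
      ((tendsto_gaussF'_one D.ha (by linarith [D.hb, D.hab]) D.hb
        (by linarith [D.ha, D.hab])).comp D.tendsto_T_end)))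
  refine tendsto_nhds_unique h1 (h2.congr' ?_)
  filter_upwards [Ioo_mem_nhdsLT D.hp₀] with p hp
  -- With F = m g, the vanishing Wronskian reads F' X₁ = m (μ g + g' T₁) after cancelling g > 0, and
  -- this form passes to the limit.
  have hW := D.wronskian_eq_zero hp
  rw [wronskian, mul_eq_zero] at hW
  have hW' := hW.resolve_left (mul_ne_zero (mul_ne_zero hp.1.ne' (D.r_ne p hp))
    (D.m_pos p (Ioo_subset_Icc_self hp)).ne')
  rw [D.gaussF_X_eq (Ioo_subset_Ico_self hp), hT₁κ p hp] at hW'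
  refine mul_right_cancel₀ (D.gaussF_T_pos (Ioo_subset_Ico_self hp)).ne' ?_
  simp only [Function.comp]
  linear_combination hW'

/-- The series for `1 / π` produced by a transformation. -/
theorem hasSum_ramanujanCoeff_linear {κ : ℝ → ℝ} (hκ : ContinuousAt κ p₀)
    (hT₁κ : ∀ p ∈ Ioo 0 p₀, D.T₁ p = κ p * (1 - D.T p) ^ (a + b)) (hX₁ : D.X₁ p₀ ≠ 0) {c d : ℝ}
    (hcd : c * D.X₁ p₀ + 2 * d * D.X p₀ * D.μ p₀ = 0) :
    HasSum (fun n : ℕ => ramanujanCoeff s n * (c + d * n) * D.X p₀ ^ n)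
      (2 * d * (D.X p₀ / D.X₁ p₀) * (D.m p₀ ^ 2 * κ p₀) *
        (Real.sin (Real.pi * a) * Real.sin (Real.pi * b) /
          (Real.pi * Real.sin (Real.pi * (a + b))))) := by
  have hX := D.X_mem p₀ (right_mem_Icc.2 D.hp₀.le)
  have h := ((hasSum_ramanujanCoeff D.hs D.hs1 hX).mul_left c).add
    ((hasSum_mul_ramanujanCoeff D.hs D.hs1 hX).mul_left d)
  have e := D.gaussF'_X_end hκ hT₁κ
  rw [← Gamma_div_mul_Gamma_div D.ha D.hb D.hab]
  rw [D.gaussF_X_end] at h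
  rw [← eq_div_iff hX₁] at e
  rw [e] at h
  convert! h using 1
  · funext n
    ring
  · generalize Real.Gamma (1 - a - b) / (Real.Gamma (1 - a) * Real.Gamma (1 - b)) = g
    generalize Real.Gamma (a + b) / (Real.Gamma a * Real.Gamma b) = k
    field_simp
    -- `hcd` says exactly that the coefficient of g² vanishes; only the product g k remains.
    linear_combination (-(D.m p₀ ^ 2 * g ^ 2)) * hcd

theorem hasSum_ramanujanCoeff_end :
    HasSum (fun n : ℕ => ramanujanCoeff s n * D.X p₀ ^ n)
      (D.m p₀ ^ 2 * (Real.Gamma (1 - a - b) / (Real.Gamma (1 - a) * Real.Gamma (1 - b))) ^ 2) := by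
  have h := hasSum_ramanujanCoeff D.hs D.hs1 (D.X_mem p₀ (right_mem_Icc.2 D.hp₀.le))
  rwa [D.gaussF_X_end, mul_pow] at h

end GaussTransformation

/-! ### Logarithmic derivatives -/

/-- With derivatives written as f · l, powers scale l and products add it; the multipliers m and r
of the first three transformations are products of real powers. -/
theorem HasDerivAt.log_rpow {f : ℝ → ℝ} {x l : ℝ} (hf : HasDerivAt f (f x * l) x) (h : 0 < f x)
    (c : ℝ) : HasDerivAt (fun p => f p ^ c) (f x ^ c * (c * l)) x := by
  refine (hf.rpow_const (p := c) (Or.inl h.ne')).congr_deriv ?_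
  rw [Real.rpow_sub_one h.ne']
  field_simp

theorem HasDerivAt.log_mul {f g : ℝ → ℝ} {x l k : ℝ} (hf : HasDerivAt f (f x * l) x)
    (hg : HasDerivAt g (g x * k) x) : HasDerivAt (fun p => f p * g p) (f x * g x * (l + k)) x :=
  (hf.mul hg).congr_deriv (by ring)

theorem hasDerivAt_one_add_mul (k x : ℝ) : HasDerivAt (fun p : ℝ => 1 + k * p) k x := by
  simpa using ((hasDerivAt_id x).const_mul k).const_add 1

theorem hasDerivAt_one_sub_mul (k x : ℝ) : HasDerivAt (fun p : ℝ => 1 - k * p) (-k) x := by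
  simpa using ((hasDerivAt_id x).const_mul k).const_sub 1

theorem HasDerivAt.log_of_ne {f : ℝ → ℝ} {x f' : ℝ} (hf : HasDerivAt f f' x) (h : f x ≠ 0) :
    HasDerivAt f (f x * (f' / f x)) x :=
  hf.congr_deriv (by field_simp)

theorem hasDerivAt_quadratic (j x : ℝ) :
    HasDerivAt (fun p : ℝ => 1 + j * p + 81 * p ^ 2) (j + 162 * x) x := by
  refine ((hasDerivAt_one_add_mul j x).add ((hasDerivAt_pow 2 x).const_mul 81)).congr_deriv ?_
  simp
  ring

/-! ### Four transformations -/

/-- The cubic transformation `q ↦ q ^ 3` for `s = 1 / 4` on the positive axis. -/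
noncomputable def cubicPos : GaussTransformation (1 / 4) (1 / 8) (3 / 8) (1 / 81) where
  X u := 256 * u ^ 3 / (1 + 3 * u) ^ 4
  T u := 256 * u / (1 + 27 * u) ^ 4
  X₁ u := 768 * u ^ 2 * (1 - u) / (1 + 3 * u) ^ 5
  T₁ u := 256 * (1 - 81 * u) / (1 + 27 * u) ^ 5
  m u := (1 + 3 * u) ^ (1 / 2 : ℝ) * (1 + 27 * u) ^ (-1 / 2 : ℝ)
  μ u := 1 / 2 * (3 / (1 + 3 * u)) + -1 / 2 * (27 / (1 + 27 * u))
  μ₁ u := -9 / 2 / (1 + 3 * u) ^ 2 + 729 / 2 / (1 + 27 * u) ^ 2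
  r u := (1 + 14 * u + 81 * u ^ 2) ^ (1 / 2 : ℝ) * (1 + 3 * u) ^ (-1 : ℝ)
  lam u := 1 / 2 * ((14 + 162 * u) / (1 + 14 * u + 81 * u ^ 2)) + -1 * (3 / (1 + 3 * u))
  ℓX u := 2 / u - 1 / (1 - u) - 15 / (1 + 3 * u)
  ℓT u := -81 / (1 - 81 * u) - 135 / (1 + 27 * u)
  A u := 3 * (1 + 3 * u) ^ 3 / (u * (1 - u) * (1 + 14 * u + 81 * u ^ 2))
  B u := (1 + 27 * u) ^ 3 / (u * (1 - 81 * u) * (1 + 14 * u + 81 * u ^ 2))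
  hs := by norm_num
  hs1 := by norm_num
  ha := by norm_num
  hb := by norm_num
  hab := by norm_num
  hp₀ := by norm_num
  X_zero := by norm_num
  T_zero := by norm_num
  m_zero := by norm_num
  T_end := by norm_num
  X_mem u hu := by
    obtain ⟨h0, h1⟩ := hu
    have h3 : (1 : ℝ) ≤ (1 + 3 * u) ^ 4 := one_le_pow₀ (by linarith)
    have h4 : u ^ 3 ≤ (1 / 81) ^ 3 := by gcongr
    rw [abs_of_nonneg (by positivity), div_lt_one (by positivity)]
    linarith
  T_mem u hu := by
    obtain ⟨h0, h1⟩ := hu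
    -- (1+27u)⁴ - 256u = (1-81u)²(1+14u+81u²), so 1 - T has a double zero at 1/81, matching a + b =
    -- 1/2.
    have h2 : 0 < (1 - 81 * u) ^ 2 := pow_pos (by linarith) 2
    have h3 : 0 < (1 - 81 * u) ^ 2 * (1 + 14 * u + 81 * u ^ 2) := by positivity
    refine ⟨by positivity, ?_⟩
    rw [div_lt_one (by positivity)]
    linarith
  m_pos u hu := by
    obtain ⟨h0, h1⟩ := hu
    positivity
  hX u hu := by
    obtain ⟨h0, h1⟩ := hu
    have hne : (1 + 3 * u) ≠ 0 := by positivity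
    refine (((hasDerivAt_pow 3 u).const_mul 256).div ((hasDerivAt_one_add_mul 3 u).pow 4)
      (pow_ne_zero 4 hne)).congr_deriv ?_
    simp
    field_simp
    ring
  hT u hu := by
    obtain ⟨h0, h1⟩ := hu
    have hne : (1 + 27 * u) ≠ 0 := by positivity
    refine (((hasDerivAt_id u).const_mul 256).div ((hasDerivAt_one_add_mul 27 u).pow 4)
      (pow_ne_zero 4 hne)).congr_deriv ?_
    simp
    field_simp
    ring
  hm u hu := by
    obtain ⟨h0, h1⟩ := hu
    have p1 : 0 < 1 + 3 * u := by positivity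
    have p2 : 0 < 1 + 27 * u := by positivity
    exact (((hasDerivAt_one_add_mul 3 u).log_of_ne p1.ne').log_rpow p1 _).log_mul
      (((hasDerivAt_one_add_mul 27 u).log_of_ne p2.ne').log_rpow p2 _)
  hμ u hu := by
    obtain ⟨h0, h1⟩ := hu
    have p1 : 1 + 3 * u ≠ 0 := by positivity
    have p2 : 1 + 27 * u ≠ 0 := by positivity
    refine ((((hasDerivAt_const u 3).div (hasDerivAt_one_add_mul 3 u) p1).const_mul (1 / 2)).add
      (((hasDerivAt_const u 27).div (hasDerivAt_one_add_mul 27 u) p2).const_mul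
        (-1 / 2))).congr_deriv ?_
    field_simp
    ring
  hr u hu := by
    obtain ⟨h0, h1⟩ := hu
    have p1 : 0 < 1 + 14 * u + 81 * u ^ 2 := by positivity
    have p2 : 0 < 1 + 3 * u := by positivity
    exact (((hasDerivAt_quadratic 14 u).log_of_ne p1.ne').log_rpow p1 _).log_mul
      (((hasDerivAt_one_add_mul 3 u).log_of_ne p2.ne').log_rpow p2 _)
  X₁_cont u hu := by
    obtain ⟨h0, h1⟩ := hu
    have : (1 + 3 * u) ^ 5 ≠ 0 := by positivity
    fun_prop (disch := assumption)
  T₁_cont u hu := by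
    obtain ⟨h0, h1⟩ := hu
    have : (1 + 27 * u) ^ 5 ≠ 0 := by positivity
    fun_prop (disch := assumption)
  r_ne u hu := by
    obtain ⟨h0, h1⟩ := hu
    positivity
  hX₁ u hu := by
    obtain ⟨h0, h1⟩ := hu
    have p1 : 1 + 3 * u ≠ 0 := by positivity
    have p2 : 1 - u ≠ 0 := by linarith
    refine ((((hasDerivAt_pow 2 u).const_mul 768).mul ((hasDerivAt_id u).const_sub 1)).div
      ((hasDerivAt_one_add_mul 3 u).pow 5) (pow_ne_zero 5 p1)).congr_deriv ?_
    simp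
    field_simp
    ring
  hT₁ u hu := by
    obtain ⟨h0, h1⟩ := hu
    have p1 : 1 + 27 * u ≠ 0 := by positivity
    have p2 : 1 - 81 * u ≠ 0 := by linarith
    refine (((hasDerivAt_one_sub_mul 81 u).const_mul 256).div
      ((hasDerivAt_one_add_mul 27 u).pow 5) (pow_ne_zero 5 p1)).congr_deriv ?_
    simp
    field_simp
    ring
  X₁_eq u hu := by
    obtain ⟨h0, h1⟩ := hu
    have p1 : 1 + 3 * u ≠ 0 := by positivity
    have p2 : 1 - u ≠ 0 := by linarith
    have p3 : 1 + 14 * u + 81 * u ^ 2 ≠ 0 := by positivity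
    have e : 1 - 256 * u ^ 3 / (1 + 3 * u) ^ 4
        = (1 - u) ^ 2 * (1 + 14 * u + 81 * u ^ 2) / (1 + 3 * u) ^ 4 := by
      field_simp
      ring
    rw [e]
    field_simp
    ring
  T₁_eq u hu := by
    obtain ⟨h0, h1⟩ := hu
    have p1 : 1 + 27 * u ≠ 0 := by positivity
    have p2 : 1 - 81 * u ≠ 0 := by linarith
    have p3 : 1 + 14 * u + 81 * u ^ 2 ≠ 0 := by positivity
    have e : 1 - 256 * u / (1 + 27 * u) ^ 4
        = (1 - 81 * u) ^ 2 * (1 + 14 * u + 81 * u ^ 2) / (1 + 27 * u) ^ 4 := by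
      field_simp
      ring
    rw [e]
    field_simp
  ode_X u hu := by
    obtain ⟨h0, h1⟩ := hu
    have p1 : 1 + 3 * u ≠ 0 := by positivity
    have p2 : 1 - u ≠ 0 := by linarith
    have p3 : 1 + 14 * u + 81 * u ^ 2 ≠ 0 := by positivity
    field_simp
    ring
  ode_T u hu := by
    obtain ⟨h0, h1⟩ := hu
    have p1 : 1 + 3 * u ≠ 0 := by positivity
    have p2 : 1 - u * 81 ≠ 0 := by linarith
    have p3 : 1 + 14 * u + 81 * u ^ 2 ≠ 0 := by positivity
    have p4 : 1 + 27 * u ≠ 0 := by positivity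
    field_simp
    ring
  ode_m u hu := by
    obtain ⟨h0, h1⟩ := hu
    have p1 : 1 + 3 * u ≠ 0 := by positivity
    have p2 : 1 - u * 81 ≠ 0 := by linarith
    have p3 : 1 + 14 * u + 81 * u ^ 2 ≠ 0 := by positivity
    have p4 : 1 + 27 * u ≠ 0 := by positivity
    have p5 : 1 - u ≠ 0 := by linarith
    field_simp
    ring

/-- The cubic transformation `q ↦ q ^ 3` for `s = 1 / 4` on the negative axis. -/
noncomputable def cubicNeg : GaussTransformation (1 / 4) (1 / 8) (5 / 8) (1 / 27) where
  -- X is that of `cubicPos` at u = -v. If t is its T at u = -v, then T here is t/(t-1): Pfaff's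
  -- transformation, which replaces 3/8 by 1 - 3/8 = 5/8, moves the negative argument into [0, 1]
  -- and multiplies m by (1-t)^(-1/8).
  X v := -256 * v ^ 3 / (1 - 3 * v) ^ 4
  T v := 256 * v / ((1 + 81 * v) ^ 2 * (1 + -14 * v + 81 * v ^ 2))
  X₁ v := -768 * v ^ 2 * (1 + 1 * v) / (1 - 3 * v) ^ 5
  T₁ v := 256 * (1 - 27 * v) ^ 3 / ((1 + 81 * v) ^ 3 * (1 + -14 * v + 81 * v ^ 2) ^ 2)
  m v := (1 - 3 * v) ^ (1 / 2 : ℝ) * (1 + 81 * v) ^ (-1 / 4 : ℝ) *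
    (1 + -14 * v + 81 * v ^ 2) ^ (-1 / 8 : ℝ)
  μ v := 1 / 2 * (-3 / (1 - 3 * v)) + -1 / 4 * (81 / (1 + 81 * v)) +
    -1 / 8 * ((-14 + 162 * v) / (1 + -14 * v + 81 * v ^ 2))
  μ₁ v := -9 / 2 / (1 - 3 * v) ^ 2 + 81 ^ 2 / 4 / (1 + 81 * v) ^ 2 +
    -1 / 8 * (162 / (1 + -14 * v + 81 * v ^ 2)
      - (-14 + 162 * v) ^ 2 / (1 + -14 * v + 81 * v ^ 2) ^ 2)
  r v := (1 + -14 * v + 81 * v ^ 2) ^ (1 / 2 : ℝ) * (1 - 3 * v) ^ (-1 : ℝ)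
  lam v := 1 / 2 * ((-14 + 162 * v) / (1 + -14 * v + 81 * v ^ 2)) + -1 * (-3 / (1 - 3 * v))
  ℓX v := 2 / v + 1 / (1 + 1 * v) + 15 / (1 - 3 * v)
  ℓT v := -81 / (1 - 27 * v) - 243 / (1 + 81 * v)
    - 2 * ((-14 + 162 * v) / (1 + -14 * v + 81 * v ^ 2))
  A v := 3 * (1 - 3 * v) ^ 3 / (v * (1 + 1 * v) * (1 + -14 * v + 81 * v ^ 2))
  B v := (1 + 81 * v) / (v * (1 - 27 * v))
  hs := by norm_num
  hs1 := by norm_num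
  ha := by norm_num
  hb := by norm_num
  hab := by norm_num
  hp₀ := by norm_num
  X_zero := by norm_num
  T_zero := by norm_num
  m_zero := by norm_num
  T_end := by norm_num
  X_mem v hv := by
    obtain ⟨h0, h1⟩ := hv
    have h2 : 8 / 9 ≤ 1 - 3 * v := by linarith
    have h3 : (8 / 9 : ℝ) ^ 4 ≤ (1 - 3 * v) ^ 4 := by gcongr
    have h4 : v ^ 3 ≤ (1 / 27) ^ 3 := by gcongr
    rw [abs_div, abs_of_pos (by linarith : 0 < (1 - 3 * v) ^ 4), abs_of_nonpos
      (by nlinarith [pow_nonneg h0 3]), div_lt_one (by linarith)]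
    linarith
  T_mem v hv := by
    obtain ⟨h0, h1⟩ := hv
    -- The denominator of T minus its numerator is (1-27v)⁴: a zero of order four, matching a + b =
    -- 3/4.
    have h2 : 0 < (1 - 27 * v) ^ 4 := pow_pos (by linarith) 4
    -- 1 - 14v + 81v² = (1-9v)² + 4v.
    have h3 : 0 < 1 + -14 * v + 81 * v ^ 2 := by nlinarith [sq_nonneg (1 - 9 * v)]
    refine ⟨by positivity, ?_⟩
    rw [div_lt_one (by positivity)]
    linarith
  m_pos v hv := by
    obtain ⟨h0, h1⟩ := hv
    have h2 : 0 < 1 - 3 * v := by linarith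
    have h3 : 0 < 1 + -14 * v + 81 * v ^ 2 := by nlinarith [sq_nonneg (1 - 9 * v)]
    positivity
  hX v hv := by
    obtain ⟨h0, h1⟩ := hv
    have p1 : 1 - 3 * v ≠ 0 := by linarith
    refine (((hasDerivAt_pow 3 v).const_mul (-256)).div ((hasDerivAt_one_sub_mul 3 v).pow 4)
      (pow_ne_zero 4 p1)).congr_deriv ?_
    simp
    field_simp
    ring
  hT v hv := by
    obtain ⟨h0, h1⟩ := hv
    have p1 : 1 + 81 * v ≠ 0 := by positivity
    have p2 : 1 + -14 * v + 81 * v ^ 2 ≠ 0 := by nlinarith [sq_nonneg (1 - 9 * v)]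
    refine (((hasDerivAt_id v).const_mul 256).div (((hasDerivAt_one_add_mul 81 v).pow 2).mul
      (hasDerivAt_quadratic (-14) v)) (mul_ne_zero (pow_ne_zero 2 p1) p2)).congr_deriv ?_
    simp only [id, Pi.mul_apply, Pi.pow_apply]
    field_simp
    ring
  hm v hv := by
    obtain ⟨h0, h1⟩ := hv
    have p1 : 0 < 1 - 3 * v := by linarith
    have p2 : 0 < 1 + 81 * v := by positivity
    have p3 : 0 < 1 + -14 * v + 81 * v ^ 2 := by nlinarith [sq_nonneg (1 - 9 * v)]
    exact ((((hasDerivAt_one_sub_mul 3 v).log_of_ne p1.ne').log_rpow p1 _).log_mul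
      (((hasDerivAt_one_add_mul 81 v).log_of_ne p2.ne').log_rpow p2 _)).log_mul
      (((hasDerivAt_quadratic (-14) v).log_of_ne p3.ne').log_rpow p3 _)
  hμ v hv := by
    obtain ⟨h0, h1⟩ := hv
    have p1 : 1 - 3 * v ≠ 0 := by linarith
    have p2 : 1 + 81 * v ≠ 0 := by positivity
    have p3 : 1 + -14 * v + 81 * v ^ 2 ≠ 0 := by nlinarith [sq_nonneg (1 - 9 * v)]
    refine (((((hasDerivAt_const v (-3)).div (hasDerivAt_one_sub_mul 3 v) p1).const_mul
      (1 / 2)).add (((hasDerivAt_const v 81).div (hasDerivAt_one_add_mul 81 v) p2).const_mul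
        (-1 / 4))).add (((((hasDerivAt_id v).const_mul 162).const_add (-14)).div
          (hasDerivAt_quadratic (-14) v) p3).const_mul (-1 / 8))).congr_deriv ?_
    simp only [id]
    field_simp
    ring
  hr v hv := by
    obtain ⟨h0, h1⟩ := hv
    have p1 : 0 < 1 - 3 * v := by linarith
    have p3 : 0 < 1 + -14 * v + 81 * v ^ 2 := by nlinarith [sq_nonneg (1 - 9 * v)]
    exact (((hasDerivAt_quadratic (-14) v).log_of_ne p3.ne').log_rpow p3 _).log_mul
      (((hasDerivAt_one_sub_mul 3 v).log_of_ne p1.ne').log_rpow p1 _)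
  X₁_cont v hv := by
    obtain ⟨h0, h1⟩ := hv
    have : (1 - 3 * v) ^ 5 ≠ 0 := pow_ne_zero _ (by linarith)
    fun_prop (disch := assumption)
  T₁_cont v hv := by
    obtain ⟨h0, h1⟩ := hv
    have p3 : 0 < 1 + -14 * v + 81 * v ^ 2 := by nlinarith [sq_nonneg (1 - 9 * v)]
    have : (1 + 81 * v) ^ 3 * (1 + -14 * v + 81 * v ^ 2) ^ 2 ≠ 0 := by positivity
    fun_prop (disch := assumption)
  r_ne v hv := by
    obtain ⟨h0, h1⟩ := hv
    have p1 : 0 < 1 - 3 * v := by linarith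
    have p3 : 0 < 1 + -14 * v + 81 * v ^ 2 := by nlinarith [sq_nonneg (1 - 9 * v)]
    positivity
  hX₁ v hv := by
    obtain ⟨h0, h1⟩ := hv
    have p1 : 1 - 3 * v ≠ 0 := by linarith
    have p1' : 1 - v * 3 ≠ 0 := by linarith
    refine ((((hasDerivAt_pow 2 v).const_mul (-768)).mul (hasDerivAt_one_add_mul 1 v)).div
      ((hasDerivAt_one_sub_mul 3 v).pow 5) (pow_ne_zero 5 p1)).congr_deriv ?_
    simp
    field_simp
    ring
  hT₁ v hv := by
    obtain ⟨h0, h1⟩ := hv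
    have p1 : 1 - 27 * v ≠ 0 := by linarith
    have p1' : 1 - v * 27 ≠ 0 := by linarith
    have p2 : 1 + 81 * v ≠ 0 := by positivity
    have p3 : 1 + -14 * v + 81 * v ^ 2 ≠ 0 := by nlinarith [sq_nonneg (1 - 9 * v)]
    refine ((((hasDerivAt_one_sub_mul 27 v).pow 3).const_mul 256).div
      (((hasDerivAt_one_add_mul 81 v).pow 3).mul ((hasDerivAt_quadratic (-14) v).pow 2))
      (mul_ne_zero (pow_ne_zero 3 p2) (pow_ne_zero 2 p3))).congr_deriv ?_
    simp only [Pi.mul_apply, Pi.pow_apply]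
    generalize hQ : 1 + -14 * v + 81 * v ^ 2 = Q at *
    field_simp
    ring
  X₁_eq v hv := by
    obtain ⟨h0, h1⟩ := hv
    have p1 : 1 - 3 * v ≠ 0 := by linarith
    have p1' : 1 - v * 3 ≠ 0 := by linarith
    obtain ⟨Q, hQ⟩ : ∃ Q, Q = 1 + -14 * v + 81 * v ^ 2 := ⟨_, rfl⟩
    have p3 : Q ≠ 0 := by nlinarith [sq_nonneg (1 - 9 * v)]
    have e : 1 - -256 * v ^ 3 / (1 - 3 * v) ^ 4
        = (1 + 1 * v) ^ 2 * (1 + -14 * v + 81 * v ^ 2) / (1 - 3 * v) ^ 4 := by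
      field_simp
      ring
    rw [e, ← hQ]
    field_simp
    ring
  T₁_eq v hv := by
    obtain ⟨h0, h1⟩ := hv
    have p1 : 1 - 27 * v ≠ 0 := by linarith
    have p3 : 1 + -14 * v + 81 * v ^ 2 ≠ 0 := by nlinarith [sq_nonneg (1 - 9 * v)]
    have e : 1 - 256 * v / ((1 + 81 * v) ^ 2 * (1 + -14 * v + 81 * v ^ 2))
        = (1 - 27 * v) ^ 4 / ((1 + 81 * v) ^ 2 * (1 + -14 * v + 81 * v ^ 2)) := by
      rw [eq_div_iff (by positivity), sub_mul, div_mul_cancel₀ _ (by positivity)]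
      ring
    rw [e]
    field_simp
  ode_X v hv := by
    obtain ⟨h0, h1⟩ := hv
    have p1 : 1 - 3 * v ≠ 0 := by linarith
    have p1' : 1 - v * 3 ≠ 0 := by linarith
    obtain ⟨Q, hQ⟩ : ∃ Q, Q = 1 + -14 * v + 81 * v ^ 2 := ⟨_, rfl⟩
    have p3 : Q ≠ 0 := by nlinarith [sq_nonneg (1 - 9 * v)]
    rw [← hQ]
    field_simp
    rw [hQ]
    ring
  ode_T v hv := by
    obtain ⟨h0, h1⟩ := hv
    have p1 : 1 - 27 * v ≠ 0 := by linarith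
    have p1' : 1 - v * 27 ≠ 0 := by linarith
    have p2 : 1 - 3 * v ≠ 0 := by linarith
    have p2' : 1 - v * 3 ≠ 0 := by linarith
    obtain ⟨Q, hQ⟩ : ∃ Q, Q = 1 + -14 * v + 81 * v ^ 2 := ⟨_, rfl⟩
    have p3 : Q ≠ 0 := by nlinarith [sq_nonneg (1 - 9 * v)]
    rw [← hQ]
    field_simp
    rw [hQ]
    ring
  ode_m v hv := by
    obtain ⟨h0, h1⟩ := hv
    have p1 : 1 - 27 * v ≠ 0 := by linarith
    have p1' : 1 - v * 27 ≠ 0 := by linarith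
    have p2 : 1 - 3 * v ≠ 0 := by linarith
    have p2' : 1 - v * 3 ≠ 0 := by linarith
    obtain ⟨Q, hQ⟩ : ∃ Q, Q = 1 + -14 * v + 81 * v ^ 2 := ⟨_, rfl⟩
    have p3 : Q ≠ 0 := by nlinarith [sq_nonneg (1 - 9 * v)]
    rw [← hQ]
    field_simp
    rw [hQ]
    ring

/-- The quadratic transformation `q ↦ q ^ 2` for `s = 1 / 6`. -/
noncomputable def quadraticNeg : GaussTransformation (1 / 6) (1 / 12) (7 / 12) (1 / 256) where
  -- T is t/(t-1) for t = -1728u/(1-256u)³, again by Pfaff, with 5/12 replaced by 7/12. The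
  -- denominator of T is (1-256u)³ + 1728u, so 1 - T has a triple zero at 1/256.
  X u := 1728 * u ^ 2 / (1 - 16 * u) ^ 3
  T u := 1728 * u / ((1 - 64 * u) * (1 + 512 * u) ^ 2)
  X₁ u := 3456 * u * (1 + 8 * u) / (1 - 16 * u) ^ 4
  T₁ u := 1728 * (1 - 256 * u) ^ 2 / ((1 - 64 * u) ^ 2 * (1 + 512 * u) ^ 3)
  m u := (1 - 16 * u) ^ (1 / 4 : ℝ) * (1 - 64 * u) ^ (-1 / 12 : ℝ) * (1 + 512 * u) ^ (-1 / 6 : ℝ)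
  μ u := 1 / 4 * (-16 / (1 - 16 * u)) + -1 / 12 * (-64 / (1 - 64 * u)) +
    -1 / 6 * (512 / (1 + 512 * u))
  μ₁ u := -64 / (1 - 16 * u) ^ 2 + 1024 / 3 / (1 - 64 * u) ^ 2 + 131072 / 3 / (1 + 512 * u) ^ 2
  r u := (1 - 64 * u) ^ (1 / 2 : ℝ) * (1 - 16 * u) ^ (-1 / 2 : ℝ)
  lam u := 1 / 2 * (-64 / (1 - 64 * u)) + -1 / 2 * (-16 / (1 - 16 * u))
  ℓX u := 1 / u + 8 / (1 + 8 * u) + 64 / (1 - 16 * u)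
  ℓT u := -512 / (1 - 256 * u) + 128 / (1 - 64 * u) - 1536 / (1 + 512 * u)
  A u := 2 * (1 - 16 * u) ^ 2 / (u * (1 - 64 * u) * (1 + 8 * u))
  B u := (1 + 512 * u) / (u * (1 - 256 * u))
  hs := by norm_num
  hs1 := by norm_num
  ha := by norm_num
  hb := by norm_num
  hab := by norm_num
  hp₀ := by norm_num
  X_zero := by norm_num
  T_zero := by norm_num
  m_zero := by norm_num
  T_end := by norm_num
  X_mem u hu := by
    obtain ⟨h0, h1⟩ := hu
    have h2 : 15 / 16 ≤ 1 - 16 * u := by linarith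
    have h3 : (15 / 16 : ℝ) ^ 3 ≤ (1 - 16 * u) ^ 3 := by gcongr
    have h4 : u ^ 2 ≤ (1 / 256) ^ 2 := by gcongr
    rw [abs_of_nonneg (div_nonneg (by positivity) (by linarith)), div_lt_one (by linarith)]
    linarith
  T_mem u hu := by
    obtain ⟨h0, h1⟩ := hu
    have h2 : 0 < (1 - 256 * u) ^ 3 := pow_pos (by linarith) 3
    have h3 : 0 < 1 - 64 * u := by linarith
    refine ⟨by positivity, ?_⟩
    rw [div_lt_one (by positivity)]
    linarith
  m_pos u hu := by
    obtain ⟨h0, h1⟩ := hu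
    have h2 : 0 < 1 - 16 * u := by linarith
    have h3 : 0 < 1 - 64 * u := by linarith
    positivity
  hX u hu := by
    obtain ⟨h0, h1⟩ := hu
    have p1 : 1 - 16 * u ≠ 0 := by linarith
    refine (((hasDerivAt_pow 2 u).const_mul 1728).div ((hasDerivAt_one_sub_mul 16 u).pow 3)
      (pow_ne_zero 3 p1)).congr_deriv ?_
    simp
    field_simp
    ring
  hT u hu := by
    obtain ⟨h0, h1⟩ := hu
    have p1 : 1 + 512 * u ≠ 0 := by positivity
    have p2 : 1 - 64 * u ≠ 0 := by linarith
    refine (((hasDerivAt_id u).const_mul 1728).div ((hasDerivAt_one_sub_mul 64 u).mul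
      ((hasDerivAt_one_add_mul 512 u).pow 2))
      (mul_ne_zero p2 (pow_ne_zero 2 p1))).congr_deriv ?_
    simp only [id, Pi.mul_apply, Pi.pow_apply]
    field_simp
    ring
  hm u hu := by
    obtain ⟨h0, h1⟩ := hu
    have p1 : 0 < 1 - 16 * u := by linarith
    have p2 : 0 < 1 - 64 * u := by linarith
    have p3 : 0 < 1 + 512 * u := by positivity
    exact ((((hasDerivAt_one_sub_mul 16 u).log_of_ne p1.ne').log_rpow p1 _).log_mul
      (((hasDerivAt_one_sub_mul 64 u).log_of_ne p2.ne').log_rpow p2 _)).log_mul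
      (((hasDerivAt_one_add_mul 512 u).log_of_ne p3.ne').log_rpow p3 _)
  hμ u hu := by
    obtain ⟨h0, h1⟩ := hu
    have p1 : 1 - 16 * u ≠ 0 := by linarith
    have p2 : 1 - 64 * u ≠ 0 := by linarith
    have p3 : 1 + 512 * u ≠ 0 := by positivity
    refine (((((hasDerivAt_const u (-16)).div (hasDerivAt_one_sub_mul 16 u) p1).const_mul
      (1 / 4)).add (((hasDerivAt_const u (-64)).div (hasDerivAt_one_sub_mul 64 u) p2).const_mul
        (-1 / 12))).add (((hasDerivAt_const u 512).div (hasDerivAt_one_add_mul 512 u)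
          p3).const_mul (-1 / 6))).congr_deriv ?_
    field_simp
    ring
  hr u hu := by
    obtain ⟨h0, h1⟩ := hu
    have p1 : 0 < 1 - 16 * u := by linarith
    have p2 : 0 < 1 - 64 * u := by linarith
    exact (((hasDerivAt_one_sub_mul 64 u).log_of_ne p2.ne').log_rpow p2 _).log_mul
      (((hasDerivAt_one_sub_mul 16 u).log_of_ne p1.ne').log_rpow p1 _)
  X₁_cont u hu := by
    obtain ⟨h0, h1⟩ := hu
    have : (1 - 16 * u) ^ 4 ≠ 0 := pow_ne_zero _ (by linarith)
    fun_prop (disch := assumption)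
  T₁_cont u hu := by
    obtain ⟨h0, h1⟩ := hu
    have p2 : 0 < 1 - 64 * u := by linarith
    have : (1 - 64 * u) ^ 2 * (1 + 512 * u) ^ 3 ≠ 0 := by positivity
    fun_prop (disch := assumption)
  r_ne u hu := by
    obtain ⟨h0, h1⟩ := hu
    have p1 : 0 < 1 - 16 * u := by linarith
    have p2 : 0 < 1 - 64 * u := by linarith
    positivity
  hX₁ u hu := by
    obtain ⟨h0, h1⟩ := hu
    have p1 : 1 - 16 * u ≠ 0 := by linarith
    have p1' : 1 - u * 16 ≠ 0 := by linarith
    refine ((((hasDerivAt_id u).const_mul 3456).mul (hasDerivAt_one_add_mul 8 u)).div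
      ((hasDerivAt_one_sub_mul 16 u).pow 4) (pow_ne_zero 4 p1)).congr_deriv ?_
    simp
    field_simp
    ring
  hT₁ u hu := by
    obtain ⟨h0, h1⟩ := hu
    have p1 : 1 - 256 * u ≠ 0 := by linarith
    have p1' : 1 - u * 256 ≠ 0 := by linarith
    have p2 : 1 + 512 * u ≠ 0 := by positivity
    have p3 : 1 - 64 * u ≠ 0 := by linarith
    have p3' : 1 - u * 64 ≠ 0 := by linarith
    refine ((((hasDerivAt_one_sub_mul 256 u).pow 2).const_mul 1728).div
      (((hasDerivAt_one_sub_mul 64 u).pow 2).mul ((hasDerivAt_one_add_mul 512 u).pow 3))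
      (mul_ne_zero (pow_ne_zero 2 p3) (pow_ne_zero 3 p2))).congr_deriv ?_
    simp only [Pi.mul_apply, Pi.pow_apply]
    field_simp
    ring
  X₁_eq u hu := by
    obtain ⟨h0, h1⟩ := hu
    have p1 : 1 - 16 * u ≠ 0 := by linarith
    have p1' : 1 - u * 16 ≠ 0 := by linarith
    have p3 : 1 - 64 * u ≠ 0 := by linarith
    have p3' : 1 - u * 64 ≠ 0 := by linarith
    have e : 1 - 1728 * u ^ 2 / (1 - 16 * u) ^ 3
        = (1 - 64 * u) * (1 + 8 * u) ^ 2 / (1 - 16 * u) ^ 3 := by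
      field_simp
      ring
    rw [e]
    field_simp
    ring
  T₁_eq u hu := by
    obtain ⟨h0, h1⟩ := hu
    have p1 : 1 - 256 * u ≠ 0 := by linarith
    have p3 : 1 - 64 * u ≠ 0 := by linarith
    have e : 1 - 1728 * u / ((1 - 64 * u) * (1 + 512 * u) ^ 2)
        = (1 - 256 * u) ^ 3 / ((1 - 64 * u) * (1 + 512 * u) ^ 2) := by
      rw [eq_div_iff (by positivity), sub_mul, div_mul_cancel₀ _ (by positivity)]
      ring
    rw [e]
    field_simp
  ode_X u hu := by
    obtain ⟨h0, h1⟩ := hu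
    have p1 : 1 - 16 * u ≠ 0 := by linarith
    have p1' : 1 - u * 16 ≠ 0 := by linarith
    have p3 : 1 - 64 * u ≠ 0 := by linarith
    have p3' : 1 - u * 64 ≠ 0 := by linarith
    field_simp
    ring
  ode_T u hu := by
    obtain ⟨h0, h1⟩ := hu
    have p1 : 1 - 16 * u ≠ 0 := by linarith
    have p1' : 1 - u * 16 ≠ 0 := by linarith
    have p2 : 1 - 256 * u ≠ 0 := by linarith
    have p2' : 1 - u * 256 ≠ 0 := by linarith
    have p3 : 1 - 64 * u ≠ 0 := by linarith
    have p3' : 1 - u * 64 ≠ 0 := by linarith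
    field_simp
    ring
  ode_m u hu := by
    obtain ⟨h0, h1⟩ := hu
    have p1 : 1 - 16 * u ≠ 0 := by linarith
    have p1' : 1 - u * 16 ≠ 0 := by linarith
    have p2 : 1 - 256 * u ≠ 0 := by linarith
    have p2' : 1 - u * 256 ≠ 0 := by linarith
    have p3 : 1 - 64 * u ≠ 0 := by linarith
    have p3' : 1 - u * 64 ≠ 0 := by linarith
    field_simp
    ring

/-- The cubic transformation `q ↦ q ^ 3` for `s = 1 / 3`, that of the cubic
arithmetic-geometric mean. -/
noncomputable def cubicMean : GaussTransformation (1 / 3) (1 / 3) (1 / 3) (1 / 2) where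
  -- X = 4w(1-w) with w = -v³, the quadratic transformation from ₂F₁(1/3, 2/3; 1; w). The cubic mean
  -- transformation followed by Pfaff's gives 1 - T = ((1-2v)/(1+v))³.
  X v := -4 * v ^ 3 * (1 + v ^ 3)
  T v := 9 * v * (1 - v + v ^ 2) / (1 + v) ^ 3
  X₁ v := -12 * v ^ 2 * (1 + 2 * v ^ 3)
  T₁ v := 9 * (1 - 2 * v) ^ 2 / (1 + v) ^ 4
  m v := 1 / (1 + v)
  μ v := -1 / (1 + v)
  μ₁ v := 1 / (1 + v) ^ 2
  r v := 1 + v ^ 3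
  lam v := 3 * v ^ 2 / (1 + v ^ 3)
  ℓX v := 2 / v + 6 * v ^ 2 / (1 + 2 * v ^ 3)
  ℓT v := -4 / (1 - 2 * v) - 4 / (1 + v)
  A v := 3 / (v * (1 + v ^ 3) * (1 + 2 * v ^ 3))
  B v := (1 + v) ^ 2 / (v * (1 - v + v ^ 2) * (1 - 2 * v))
  hs := by norm_num
  hs1 := by norm_num
  ha := by norm_num
  hb := by norm_num
  hab := by norm_num
  hp₀ := by norm_num
  X_zero := by norm_num
  T_zero := by norm_num
  m_zero := by norm_num
  T_end := by norm_num
  X_mem v hv := by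
    obtain ⟨h0, h1⟩ := hv
    have h4 : v ^ 3 ≤ (1 / 2) ^ 3 := by gcongr
    have h5 : 0 ≤ v ^ 3 := by positivity
    rw [abs_lt]
    constructor <;> nlinarith
  T_mem v hv := by
    obtain ⟨h0, h1⟩ := hv
    have h2 : 0 < (1 - 2 * v) ^ 3 := pow_pos (by linarith) 3
    have h3 : 0 < 1 - v + v ^ 2 := by nlinarith
    refine ⟨by positivity, ?_⟩
    rw [div_lt_one (by positivity)]
    linarith
  m_pos v hv := by
    obtain ⟨h0, h1⟩ := hv
    positivity
  hX v hv := by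
    refine (((hasDerivAt_pow 3 v).const_mul (-4)).mul
      ((hasDerivAt_pow 3 v).const_add 1)).congr_deriv ?_
    simp
    ring
  hT v hv := by
    obtain ⟨h0, h1⟩ := hv
    have p1 : 1 + v ≠ 0 := by positivity
    refine ((((hasDerivAt_id v).const_mul 9).mul
      (((hasDerivAt_id v).const_sub 1).add (hasDerivAt_pow 2 v))).div
        (((hasDerivAt_id v).const_add 1).pow 3) (pow_ne_zero 3 p1)).congr_deriv ?_
    simp
    field_simp
    ring
  hm v hv := by
    obtain ⟨h0, h1⟩ := hv
    have p1 : 1 + v ≠ 0 := by positivity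
    refine ((hasDerivAt_const v 1).div ((hasDerivAt_id v).const_add 1) p1).congr_deriv ?_
    simp
    field_simp
  hμ v hv := by
    obtain ⟨h0, h1⟩ := hv
    have p1 : 1 + v ≠ 0 := by positivity
    refine ((hasDerivAt_const v (-1)).div ((hasDerivAt_id v).const_add 1) p1).congr_deriv ?_
    simp
  hr v hv := by
    obtain ⟨h0, h1⟩ := hv
    refine ((hasDerivAt_pow 3 v).const_add 1).congr_deriv ?_
    simp
    field_simp
  X₁_cont v hv := by fun_prop
  T₁_cont v hv := by
    obtain ⟨h0, h1⟩ := hv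
    have : (1 + v) ^ 4 ≠ 0 := by positivity
    fun_prop (disch := assumption)
  r_ne v hv := by
    obtain ⟨h0, h1⟩ := hv
    positivity
  hX₁ v hv := by
    obtain ⟨h0, h1⟩ := hv
    refine (((hasDerivAt_pow 2 v).const_mul (-12)).mul
      (((hasDerivAt_pow 3 v).const_mul 2).const_add 1)).congr_deriv ?_
    simp
    field_simp
    ring
  hT₁ v hv := by
    obtain ⟨h0, h1⟩ := hv
    have p1 : 1 + v ≠ 0 := by positivity
    have p2 : 1 - 2 * v ≠ 0 := by linarith
    refine ((((hasDerivAt_one_sub_mul 2 v).pow 2).const_mul 9).div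
        (((hasDerivAt_id v).const_add 1).pow 4) (pow_ne_zero 4 p1)).congr_deriv ?_
    simp
    field_simp
    ring
  X₁_eq v hv := by
    obtain ⟨h0, h1⟩ := hv
    field_simp
    ring
  T₁_eq v hv := by
    obtain ⟨h0, h1⟩ := hv
    have p2 : 1 - 2 * v ≠ 0 := by linarith
    have p3 : 1 - v + v ^ 2 ≠ 0 := by nlinarith
    have e : 1 - 9 * v * (1 - v + v ^ 2) / (1 + v) ^ 3 = (1 - 2 * v) ^ 3 / (1 + v) ^ 3 := by
      field_simp
      ring
    rw [e]
    field_simp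
  ode_X v hv := by
    obtain ⟨h0, h1⟩ := hv
    field_simp
    ring
  ode_T v hv := by
    obtain ⟨h0, h1⟩ := hv
    have p2 : 1 - 2 * v ≠ 0 := by linarith
    have p2' : 1 - v * 2 ≠ 0 := by linarith
    have p3 : 1 - v + v ^ 2 ≠ 0 := by nlinarith
    field_simp
    ring
  ode_m v hv := by
    obtain ⟨h0, h1⟩ := hv
    have p2 : 1 - 2 * v ≠ 0 := by linarith
    have p2' : 1 - v * 2 ≠ 0 := by linarith
    have p3 : 1 - v + v ^ 2 ≠ 0 := by nlinarith
    field_simp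
    ring

/-! ### The series -/

/-- This and the next lemma serve the cases b = 1/2 - a and b = a + 1/2 of the sine product, with x
= πa. -/
theorem sin_mul_sin_half_pi_sub (x : ℝ) :
    Real.sin x * Real.sin (Real.pi / 2 - x) = Real.sin (2 * x) / 2 := by
  rw [Real.sin_pi_div_two_sub, Real.sin_two_mul]
  ring

theorem sin_mul_sin_add_half_pi (x : ℝ) :
    Real.sin x * Real.sin (x + Real.pi / 2) = Real.sin (2 * x) / 2 := by
  rw [Real.sin_add_pi_div_two, Real.sin_two_mul]
  ring

theorem sq_rpow {x : ℝ} (hx : 0 ≤ x) (c : ℝ) : (x ^ c) ^ 2 = x ^ (2 * c) := by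
  rw [← Real.rpow_natCast, ← Real.rpow_mul hx, mul_comm]
  norm_num

/-- Used on 1 - T = ℓ^n / y with ℓ vanishing at p₀: as n(a+b) = n - 1, the power (1-T)^(a+b)
contains the same integral power of ℓ as T₁. -/
theorem pow_div_rpow {x y : ℝ} (hx : 0 ≤ x) (hy : 0 ≤ y) (n : ℕ) (c : ℝ) :
    (x ^ n / y) ^ c = x ^ (n * c) / y ^ c := by
  rw [Real.div_rpow (by positivity) hy, ← Real.rpow_natCast, ← Real.rpow_mul hx]

/-- The end point of `cubicPos`, where X(1/81) = 1/7⁴ and -2Xμ/X₁ = 3/40. -/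
theorem hasSum_ramanujan_40 :
    HasSum (fun n : ℕ => ramanujanCoeff (1 / 4) n * (3 + 40 * (n : ℝ)) * (1 / 7 ^ (4 * n)))
      (49 * √3 / (9 * Real.pi)) := by
  have h := cubicPos.hasSum_ramanujanCoeff_linear
    -- T₁ divided by (1-T)^(1/2), the common factor 1 - 81u cancelled.
    (κ := fun u => 256 / ((1 + 27 * u) ^ 3 * (1 + 14 * u + 81 * u ^ 2) ^ (1 / 2 : ℝ)))
    (by
      have h1 : (1 + 14 * (1 / 81 : ℝ) + 81 * (1 / 81) ^ 2) ≠ 0 ∨ (0 : ℝ) ≤ 1 / 2 := by norm_num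
      have h2 : ((1 + 27 * (1 / 81 : ℝ)) ^ 3 *
        (1 + 14 * (1 / 81) + 81 * (1 / 81) ^ 2) ^ (1 / 2 : ℝ)) ≠ 0 := by positivity
      exact continuousAt_const.div ((by fun_prop : ContinuousAt _ _).mul
        (ContinuousAt.rpow_const (by fun_prop) h1)) h2)
    (by
      rintro u ⟨h0, h1⟩
      have h2 : 0 < 1 - 81 * u := by linarith
      have h3 : 0 < 1 + 14 * u + 81 * u ^ 2 := by positivity
      have e : 1 - 256 * u / (1 + 27 * u) ^ 4
          = (1 - 81 * u) ^ 2 / ((1 + 27 * u) ^ 4 / (1 + 14 * u + 81 * u ^ 2)) := by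
        field_simp
        ring
      have e2 : ((1 + 27 * u) ^ 4 / (1 + 14 * u + 81 * u ^ 2)) ^ (1 / 2 : ℝ)
          = (1 + 27 * u) ^ 2 / (1 + 14 * u + 81 * u ^ 2) ^ (1 / 2 : ℝ) := by
        rw [pow_div_rpow (by positivity) h3.le]
        norm_num
      simp only [cubicPos]
      rw [e, show (1 / 8 + 3 / 8 : ℝ) = 1 / 2 by norm_num, pow_div_rpow h2.le (by positivity), e2]
      norm_num
      field_simp)
    (by norm_num [cubicPos]) (c := 3) (d := 40) (by norm_num [cubicPos])
  convert! h using 1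
  · funext n
    rw [pow_mul, ← one_div_pow]
    norm_num [cubicPos]
  · have s1 : Real.sin (Real.pi * (1 / 8)) * Real.sin (Real.pi * (3 / 8)) = √2 / 4 := by
      have := sin_mul_sin_half_pi_sub (Real.pi * (1 / 8))
      rw [show Real.pi / 2 - Real.pi * (1 / 8) = Real.pi * (3 / 8) by ring,
        show 2 * (Real.pi * (1 / 8)) = Real.pi / 4 by ring, Real.sin_pi_div_four] at this
      rw [this]
      ring
    have s2 : Real.sin (Real.pi * (1 / 8 + 3 / 8)) = 1 := by
      rw [show Real.pi * (1 / 8 + 3 / 8) = Real.pi / 2 by ring, Real.sin_pi_div_two]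
    have q : (1 + 14 * (1 / 81 : ℝ) + 81 * (1 / 81) ^ 2) ^ (1 / 2 : ℝ) = 4 * √2 * √3 / 9 := by
      rw [← Real.sqrt_eq_rpow, Real.sqrt_eq_iff_mul_self_eq (by positivity) (by positivity)]
      have h2 : √2 * √2 = 2 := Real.mul_self_sqrt (by norm_num)
      have h3 : √3 * √3 = 3 := Real.mul_self_sqrt (by norm_num)
      linear_combination (-16 / 81) * √3 * √3 * h2 - (32 / 81) * h3
    rw [s1, s2, q]
    simp only [cubicPos]
    rw [mul_pow, sq_rpow (by norm_num), sq_rpow (by norm_num)]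
    have h3 : √3 * √3 = 3 := Real.mul_self_sqrt (by norm_num)
    have hpi := Real.pi_pos
    norm_num [Real.rpow_neg_one]
    field_simp
    rw [sq, h3]
    norm_num

/-- The value κ(1/27) for `hasSum_ramanujan_28`. The power of 16/27 is kept, to be merged with that
of `cubicNeg_m_sq`: the exponents 3/4 and -1/4 add up to a square root. -/
theorem cubicNeg_leading_coeff :
    256 * ((1 + 81 * (1 / 27 : ℝ)) ^ 2 * (1 + -14 * (1 / 27) + 81 * (1 / 27) ^ 2)) ^ (3 / 4 : ℝ) /
      ((1 + 81 * (1 / 27)) ^ 3 * (1 + -14 * (1 / 27) + 81 * (1 / 27) ^ 2) ^ 2)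
      = 81 * 9 / 8 * (16 / 27) ^ (3 / 4 : ℝ) := by
  have : ((16 : ℝ) * (16 / 27)) ^ (3 / 4 : ℝ) = 8 * (16 / 27) ^ (3 / 4 : ℝ) := by
    rw [Real.mul_rpow (by norm_num) (by norm_num), show (16 : ℝ) = 2 ^ (4 : ℝ) by norm_num,
      ← Real.rpow_mul (by norm_num)]
    norm_num
  norm_num at this ⊢
  rw [this]
  ring

theorem cubicNeg_m_sq : cubicNeg.m (1 / 27) ^ 2 = 4 / 9 * (16 / 27) ^ (-1 / 4 : ℝ) := by
  simp only [cubicNeg]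
  rw [mul_pow, mul_pow, sq_rpow (by norm_num), sq_rpow (by norm_num), sq_rpow (by norm_num)]
  norm_num

theorem hasSum_ramanujan_28 :
    HasSum (fun n : ℕ => ramanujanCoeff (1 / 4) n * (3 + 28 * (n : ℝ)) * (-1 / 48) ^ n)
      (16 / (Real.pi * √3)) := by
  have h := cubicNeg.hasSum_ramanujanCoeff_linear
    (κ := fun v => 256 * ((1 + 81 * v) ^ 2 * (1 + -14 * v + 81 * v ^ 2)) ^ (3 / 4 : ℝ) /
      ((1 + 81 * v) ^ 3 * (1 + -14 * v + 81 * v ^ 2) ^ 2))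
    (by
      refine ContinuousAt.div (continuousAt_const.mul (ContinuousAt.rpow_const (by fun_prop)
        (by norm_num))) (by fun_prop) (by norm_num))
    (by
      rintro v ⟨h0, h1⟩
      have h2 : 0 < 1 - 27 * v := by linarith
      have h3 : 0 < 1 + -14 * v + 81 * v ^ 2 := by nlinarith [sq_nonneg (1 - 9 * v)]
      have e : 1 - 256 * v / ((1 + 81 * v) ^ 2 * (1 + -14 * v + 81 * v ^ 2))
          = (1 - 27 * v) ^ 4 / ((1 + 81 * v) ^ 2 * (1 + -14 * v + 81 * v ^ 2)) := by
        rw [eq_div_iff (by positivity), sub_mul, div_mul_cancel₀ _ (by positivity)]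
        ring
      simp only [cubicNeg]
      rw [e, show (1 / 8 + 5 / 8 : ℝ) = 3 / 4 by norm_num, pow_div_rpow h2.le (by positivity)]
      generalize 1 + -14 * v + 81 * v ^ 2 = Q at *
      norm_num
      field_simp)
    (by norm_num [cubicNeg]) (c := 3) (d := 28) (by norm_num [cubicNeg])
  rw [cubicNeg_leading_coeff, cubicNeg_m_sq] at h
  convert! h using 1
  · funext n
    norm_num [cubicNeg]
  · have s1 : Real.sin (Real.pi * (1 / 8)) * Real.sin (Real.pi * (5 / 8)) = √2 / 4 := by
      have := sin_mul_sin_add_half_pi (Real.pi * (1 / 8))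
      rw [show Real.pi * (1 / 8) + Real.pi / 2 = Real.pi * (5 / 8) by ring,
        show 2 * (Real.pi * (1 / 8)) = Real.pi / 4 by ring, Real.sin_pi_div_four] at this
      rw [this]
      ring
    have s2 : Real.sin (Real.pi * (1 / 8 + 5 / 8)) = √2 / 2 := by
      rw [show Real.pi * (1 / 8 + 5 / 8) = Real.pi - Real.pi / 4 by ring, Real.sin_pi_sub,
        Real.sin_pi_div_four]
    have q : (16 / 27 : ℝ) ^ (-1 / 4 : ℝ) * (16 / 27) ^ (3 / 4 : ℝ) = 4 * √3 / 9 := by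
      rw [← Real.rpow_add (by norm_num), show (-1 / 4 + 3 / 4 : ℝ) = 1 / 2 by norm_num,
        ← Real.sqrt_eq_rpow, Real.sqrt_eq_iff_mul_self_eq (by positivity) (by positivity)]
      have h3 : √3 * √3 = 3 := Real.mul_self_sqrt (by norm_num)
      linear_combination (-16 / 81) * h3
    have h3 : √3 * √3 = 3 := Real.mul_self_sqrt (by norm_num)
    have hpi := Real.pi_pos
    rw [s1, s2, show 4 / 9 * (16 / 27 : ℝ) ^ (-1 / 4 : ℝ) * (81 * 9 / 8 * (16 / 27) ^ (3 / 4 : ℝ))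
      = 4 / 9 * (81 * 9 / 8) * (4 * √3 / 9) by rw [← q]; ring]
    norm_num [cubicNeg]
    field_simp
    rw [sq, h3]
    norm_num

/-- Here G = Γ(1/4)/(Γ(7/8)Γ(3/8)). Duplication at 3/8 and reflection at 1/4 reduce it to Γ(3/4). -/
theorem hasSum_ramanujanCoeff_quarter :
    HasSum (fun n : ℕ => ramanujanCoeff (1 / 4) n * (-1 / 48) ^ n)
      ((2 : ℝ) ^ (3 / 2 : ℝ) * Real.pi / ((3 : ℝ) ^ (5 / 4 : ℝ) * Real.Gamma (3 / 4) ^ 4)) := by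
  have h := cubicNeg.hasSum_ramanujanCoeff_end
  rw [cubicNeg_m_sq] at h
  have g0 : 0 < Real.Gamma (3 / 4) := Real.Gamma_pos_of_pos (by norm_num)
  have hpi := Real.pi_pos
  have h2 : √2 * √2 = 2 := Real.mul_self_sqrt (by norm_num)
  have g1 : Real.Gamma (1 / 4) * Real.Gamma (3 / 4) = Real.pi * √2 := by
    have := Real.Gamma_mul_Gamma_one_sub (1 / 4)
    rw [show Real.pi * (1 / 4) = Real.pi / 4 by ring, Real.sin_pi_div_four,
      show (1 - 1 / 4 : ℝ) = 3 / 4 by norm_num] at this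
    rw [this]
    field_simp
    rw [sq, h2]
  have g2 : Real.Gamma (7 / 8) * Real.Gamma (3 / 8)
      = Real.Gamma (3 / 4) * 2 ^ (1 / 4 : ℝ) * √Real.pi := by
    have := Real.Gamma_mul_Gamma_add_half (3 / 8)
    norm_num at this ⊢
    rw [← this, mul_comm]
  have h8 : ((2 : ℝ) ^ (1 / 4 : ℝ)) ^ 2 = √2 := by
    rw [sq_rpow (by norm_num), Real.sqrt_eq_rpow]
    norm_num
  have hp2 : √Real.pi ^ 2 = Real.pi := Real.sq_sqrt hpi.le
  have hG : (Real.Gamma (1 / 4) / (Real.Gamma (7 / 8) * Real.Gamma (3 / 8))) ^ 2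
      = Real.pi * √2 / Real.Gamma (3 / 4) ^ 4 := by
    rw [g2, eq_div_of_mul_eq g0.ne' g1, div_pow, div_pow, mul_pow, mul_pow, mul_pow, h8, hp2]
    field_simp
  have e1 : (16 / 27 : ℝ) ^ (-1 / 4 : ℝ) = 3 ^ (3 / 4 : ℝ) / 2 := by
    rw [show (16 / 27 : ℝ) = 2 ^ (4 : ℝ) / 3 ^ (3 : ℝ) by norm_num,
      Real.div_rpow (by positivity) (by positivity), ← Real.rpow_mul (by norm_num),
      ← Real.rpow_mul (by norm_num), show (4 * (-1 / 4) : ℝ) = -1 by norm_num,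
      Real.rpow_neg_one,
      show (3 * (-1 / 4) : ℝ) = -(3 / 4) by norm_num, Real.rpow_neg (by norm_num), div_inv_eq_mul]
    ring
  have e2 : (2 : ℝ) ^ (3 / 2 : ℝ) = 2 * √2 := by
    rw [show (3 / 2 : ℝ) = 1 + 1 / 2 by norm_num, Real.rpow_add (by norm_num), Real.rpow_one,
      Real.sqrt_eq_rpow]
  have e3 : (3 : ℝ) ^ (3 / 4 : ℝ) * 3 ^ (5 / 4 : ℝ) = 9 := by
    rw [← Real.rpow_add (by norm_num)]
    norm_num
  convert! h using 1
  · funext n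
    norm_num [cubicNeg]
  · rw [show (1 - 1 / 8 - 5 / 8 : ℝ) = 1 / 4 by norm_num, show (1 - 1 / 8 : ℝ) = 7 / 8 by norm_num,
      show (1 - 5 / 8 : ℝ) = 3 / 8 by norm_num, hG, e1, e2]
    have := Real.rpow_pos_of_pos (by norm_num : (0 : ℝ) < 3) (5 / 4)
    generalize (3 : ℝ) ^ (3 / 4 : ℝ) = x at *
    generalize (3 : ℝ) ^ (5 / 4 : ℝ) = y at *
    field_simp
    linear_combination (-4) * e3

theorem hasSum_ramanujan_11 :
    HasSum (fun n : ℕ => ramanujanCoeff (1 / 6) n * (1 + 11 * (n : ℝ)) * (4 / 125) ^ n)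
      (5 * √5 / (2 * Real.pi * √3)) := by
  have h := quadraticNeg.hasSum_ramanujanCoeff_linear
    (κ := fun u => 1728 * ((1 - 64 * u) * (1 + 512 * u) ^ 2) ^ (2 / 3 : ℝ) /
      ((1 - 64 * u) ^ 2 * (1 + 512 * u) ^ 3))
    (by
      refine ContinuousAt.div (continuousAt_const.mul (ContinuousAt.rpow_const (by fun_prop)
        (by norm_num))) (by fun_prop) (by norm_num))
    (by
      rintro u ⟨h0, h1⟩
      have h2 : 0 < 1 - 256 * u := by linarith
      have h3 : 0 < 1 - 64 * u := by linarith
      have e : 1 - 1728 * u / ((1 - 64 * u) * (1 + 512 * u) ^ 2)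
          = (1 - 256 * u) ^ 3 / ((1 - 64 * u) * (1 + 512 * u) ^ 2) := by
        rw [eq_div_iff (by positivity), sub_mul, div_mul_cancel₀ _ (by positivity)]
        ring
      simp only [quadraticNeg]
      rw [e, show (1 / 12 + 7 / 12 : ℝ) = 2 / 3 by norm_num, pow_div_rpow h2.le (by positivity)]
      generalize 1 - 64 * u = w at *
      norm_num
      field_simp)
    (by norm_num [quadraticNeg]) (c := 1) (d := 11) (by norm_num [quadraticNeg])
  convert! h using 1
  · funext n
    norm_num [quadraticNeg]
  · have s1 : Real.sin (Real.pi * (1 / 12)) * Real.sin (Real.pi * (7 / 12)) = 1 / 4 := by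
      have := sin_mul_sin_add_half_pi (Real.pi * (1 / 12))
      rw [show Real.pi * (1 / 12) + Real.pi / 2 = Real.pi * (7 / 12) by ring,
        show 2 * (Real.pi * (1 / 12)) = Real.pi / 6 by ring, Real.sin_pi_div_six] at this
      rw [this]
      ring
    have s2 : Real.sin (Real.pi * (1 / 12 + 7 / 12)) = √3 / 2 := by
      rw [show Real.pi * (1 / 12 + 7 / 12) = Real.pi - Real.pi / 3 by ring, Real.sin_pi_sub,
        Real.sin_pi_div_three]
    have q : quadraticNeg.m (1 / 256) ^ 2 * (1728 *
        ((1 - 64 * (1 / 256)) * (1 + 512 * (1 / 256)) ^ 2) ^ (2 / 3 : ℝ) /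
        ((1 - 64 * (1 / 256)) ^ 2 * (1 + 512 * (1 / 256)) ^ 3)) = 128 * √5 := by
      have a1 : (15 / 16 : ℝ) ^ (1 / 2 : ℝ) = √3 * √5 / 4 := by
        rw [← Real.sqrt_eq_rpow, Real.sqrt_eq_iff_mul_self_eq (by positivity) (by positivity)]
        have h3 : √3 * √3 = 3 := Real.mul_self_sqrt (by norm_num)
        have h5 : √5 * √5 = 5 := Real.mul_self_sqrt (by norm_num)
        linear_combination -√5 * √5 / 16 * h3 - 3 / 16 * h5
      -- Since 3^(-1/3) = 9^(-1/6), the first two factors merge into (27/4)^(-1/6), and -1/6 + 2/3 =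
      -- 1/2 leaves a square root.
      have a2 : (3 / 4 : ℝ) ^ (-1 / 6 : ℝ) * 3 ^ (-1 / 3 : ℝ) * (27 / 4) ^ (2 / 3 : ℝ)
          = 3 * √3 / 2 := by
        have : (3 : ℝ) ^ (-1 / 3 : ℝ) = 9 ^ (-1 / 6 : ℝ) := by
          rw [show (9 : ℝ) = 3 ^ (2 : ℝ) by norm_num, ← Real.rpow_mul (by norm_num)]
          norm_num
        rw [this, ← Real.mul_rpow (by norm_num) (by norm_num), show (3 / 4 * 9 : ℝ) = 27 / 4 by
          norm_num, ← Real.rpow_add (by norm_num), show (-1 / 6 + 2 / 3 : ℝ) = 1 / 2 by norm_num,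
          ← Real.sqrt_eq_rpow, Real.sqrt_eq_iff_mul_self_eq (by positivity) (by positivity)]
        have h3 : √3 * √3 = 3 := Real.mul_self_sqrt (by norm_num)
        linear_combination (-9 / 4) * h3
      have h3 : √3 * √3 = 3 := Real.mul_self_sqrt (by norm_num)
      simp only [quadraticNeg]
      rw [mul_pow, mul_pow, sq_rpow (by norm_num), sq_rpow (by norm_num), sq_rpow (by norm_num)]
      norm_num at a1 a2 ⊢
      rw [a1]
      linear_combination (256 / 9 * √3 * √5) * a2 + 128 / 3 * √5 * h3
    have hpi := Real.pi_pos
    rw [s1, s2, q]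
    norm_num [quadraticNeg]
    field_simp
    norm_num

/-- The end point of `cubicMean`, where X(1/2) = -9/16. As 1 - T is a perfect cube and a + b = 2/3,
κ is rational. -/
theorem hasSum_ramanujan_5 :
    HasSum (fun n : ℕ => ramanujanCoeff (1 / 3) n * (1 + 5 * (n : ℝ)) * (-9 / 16) ^ n)
      (4 / (Real.pi * √3)) := by
  have h := cubicMean.hasSum_ramanujanCoeff_linear (κ := fun v => 9 / (1 + v) ^ 2)
    (by
      refine ContinuousAt.div continuousAt_const (by fun_prop) (by norm_num))
    (by
      rintro v ⟨h0, h1⟩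
      have h2 : 0 < 1 - 2 * v := by linarith
      have e : 1 - 9 * v * (1 - v + v ^ 2) / (1 + v) ^ 3 = ((1 - 2 * v) / (1 + v)) ^ 3 / 1 := by
        field_simp
        ring
      simp only [cubicMean]
      rw [e, pow_div_rpow (by positivity) zero_le_one]
      norm_num
      field_simp)
    (by norm_num [cubicMean]) (c := 1) (d := 5) (by norm_num [cubicMean])
  convert! h using 1
  · funext n
    norm_num [cubicMean]
  · have s1 : Real.sin (Real.pi * (1 / 3)) = √3 / 2 := by
      rw [show Real.pi * (1 / 3) = Real.pi / 3 by ring, Real.sin_pi_div_three]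
    have s2 : Real.sin (Real.pi * (1 / 3 + 1 / 3)) = √3 / 2 := by
      rw [show Real.pi * (1 / 3 + 1 / 3) = Real.pi - Real.pi / 3 by ring, Real.sin_pi_sub,
        Real.sin_pi_div_three]
    have h3 : √3 * √3 = 3 := Real.mul_self_sqrt (by norm_num)
    have hpi := Real.pi_pos
    rw [s1, s2]
    norm_num [cubicMean]
    field_simp
    rw [sq, h3]
    norm_num

theorem mainTheorem5 :
    HasSum (fun n : ℕ => ramanujanCoeff (1 / 4) n * (3 + 40 * (n : ℝ)) * (1 / 7 ^ (4 * n)))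
      (49 * √3 / (9 * Real.pi)) ∧
    HasSum (fun n : ℕ => ramanujanCoeff (1 / 4) n * (3 + 28 * (n : ℝ)) * (-1 / 48) ^ n)
      (16 / (Real.pi * √3)) ∧
    HasSum (fun n : ℕ => ramanujanCoeff (1 / 4) n * (-1 / 48) ^ n)
      ((2 : ℝ) ^ (3 / 2 : ℝ) * Real.pi / ((3 : ℝ) ^ (5 / 4 : ℝ) * Real.Gamma (3 / 4) ^ 4)) ∧
    HasSum (fun n : ℕ => ramanujanCoeff (1 / 6) n * (1 + 11 * (n : ℝ)) * (4 / 125) ^ n)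
      (5 * √5 / (2 * Real.pi * √3)) ∧
    HasSum (fun n : ℕ => ramanujanCoeff (1 / 3) n * (1 + 5 * (n : ℝ)) * (-9 / 16) ^ n)
      (4 / (Real.pi * √3)) :=
  ⟨hasSum_ramanujan_40, hasSum_ramanujan_28, hasSum_ramanujanCoeff_quarter, hasSum_ramanujan_11,
    hasSum_ramanujan_5⟩
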